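/- Let $q$ be a prime power. For a linear code $D\subseteq\mathbb F_{q^2}^m$ write $\langle x,y\rangle_H=\sum_i x_iy_i^q$, let $D^{\perp_H}$ be its Hermitian dual and $\mathrm{Hull}_H(D)=D\cap D^{\perp_H}$. For $S\subseteq\mathbb F_{q^2}^m$ let $\mathrm{wt}(S)$ be the smallest Hamming weight of a nonzero vector of $S$, with $\mathrm{wt}(S)=m+1$ if there is none. An $[[m,\kappa,\delta;c]]_q$ code (entanglement-assisted quantum code) is a space of states $(V\otimes\mathrm{id})(\psi\otimes\Phi)$, where $\psi$ ranges over the states of $\kappa$ $q$-dimensional qudits, $\Phi$ is the state of $c$ maximally entangled pairs of qudits shared by sender and receiver, and $V$ is an isometry from the $\kappa$ logical qudits and the sender's $c$ halves into $m$ qudits (equivalently, a unitary after adjoining $m-\kappa-c$ ancillas). Its distance $\delta$ is the largest number $\le m+1$ such that all errors acting on fewer than $\delta$ of the $m$ sent qudits satisfy the Knill--Laflamme detection condition; if $\kappa=0$ the code is required to be pure, i.e. the expectation of each such error $E$ must equal $\mathrm{tr}(E)/q^m$. A $k$-dimensional linear code $\mathcal C\subseteq\mathbb F_{q^2}^m$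 gives, by the Hermitian construction, an $[[m,\kappa,\delta;c]]_q$ code with $c=k-\dim\mathrm{Hull}_H(\mathcal C)$, $\kappa=m-2k+c$, and $\delta=\mathrm{wt}(\mathcal C^{\perp_H})$ if $\mathcal C^{\perp_H}\subseteq\mathcal C$, $\delta=\mathrm{wt}(\mathcal C^{\perp_H}\setminus\mathrm{Hull}_H(\mathcal C))$ otherwise. The code is pure if $\delta=\mathrm{wt}(\mathcal C^{\perp_H})$. **Theorem (Less Entanglement).** Suppose that a pure $[[n,\kappa,\delta;c]]_q$ code with $c\ge 1$ is obtained by the Hermitian construction from a linear code $\mathcal C\subseteq\mathbb F_{q^2}^n$. Then there exists an $[[n+1,\kappa,\delta';c-1]]_q$ code with $\delta'\le\delta$, again obtained by the Hermitian construction. More precisely, there is $v\in\mathcal C$ with $\langle v,v\rangle_H\neq 0$, and for every such $v$ there are $\beta\in\mathbb F_{q^2}^{*}$ with $\langle v,v\rangle_H+\beta^{q+1}=0$ and a linear code $\mathcal C'\subseteq\mathbb F_{q^2}^{n+1}$ such that ${\mathcal C'}^{\perp_H}$ is generated by the vectors $(x\mid 0)$, $x\in\mathcal C^{\perp_H}$,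 and $(v\mid\beta)$; one has $\mathrm{wt}({\mathcal C'}^{\perp_H})=\min\{\delta,d_0+1\}$ with $d_0=\mathrm{wt}(\mathcal C^{\perp_H}+\langle v\rangle)$; and the Hermitian construction assigns to $\mathcal C'$ parameters $[[n+1,\kappa,\delta';c-1]]_q$ with $\delta'\le\delta$, for which an entanglement-assisted quantum code exists. -/

import Mathlib

/-! ### Linear codes over a field with `q ^ 2` elements -/

section Classical

variable {K : Type*} [Field K] {n : ℕ}

/-- The Hermitian form `∑ i, x i * (y i) ^ q` on `K ^ n`, where `|K| = q ^ 2`. -/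
def hermForm (q : ℕ) (x y : Fin n → K) : K := ∑ i, x i * y i ^ q

/-- The Hermitian dual of a linear code. -/
def hermDual (q : ℕ) (C : Submodule K (Fin n → K)) : Submodule K (Fin n → K) where
  carrier := {x | ∀ y ∈ C, hermForm q x y = 0}
  zero_mem' := by
    intro y _
    simp [hermForm]
  add_mem' := by
    intro a b ha hb y hy
    have h1 := ha y hy
    have h2 := hb y hy
    simp only [hermForm] at h1 h2 ⊢
    simp [add_mul, Finset.sum_add_distrib, h1, h2]
  smul_mem' := by
    intro r a ha y hy
    have h1 := ha y hy
    simp only [hermForm] at h1 ⊢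
    simp [mul_assoc, ← Finset.mul_sum, h1]

/-- The Hermitian hull `C ∩ C^⊥H`. -/
def hermHull (q : ℕ) (C : Submodule K (Fin n → K)) : Submodule K (Fin n → K) :=
  C ⊓ hermDual q C

open scoped Classical in
/-- `wt S`, the smallest Hamming weight of a nonzero vector of `S ⊆ K ^ n`. If `S` has no nonzero
vector, the value is `n + 1` (all weights are at most `n`, so the extra element `n + 1` matters
only then). -/
noncomputable def minWt (S : Set (Fin n → K)) : ℕ :=
  sInf ({w | ∃ v ∈ S, v ≠ 0 ∧ hammingNorm v = w} ∪ {n + 1})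

/-- `[[n, κ, δ; c]]_q` are the parameters that the Hermitian construction assigns to the
linear code `C` of length `n` over the field with `q ^ 2` elements:
`c = k - dim Hull C`, `κ = n - 2 k + c`, and `δ = wt (C^⊥H)` if `C^⊥H ⊆ C`,
`δ = wt (C^⊥H \ Hull C)` otherwise. -/
structure IsHermitianConstruction (q : ℕ) (C : Submodule K (Fin n → K)) (κ δ c : ℕ) : Prop where
  ebits : c + Module.finrank K (hermHull q C) = Module.finrank K C
  logical : κ + 2 * Module.finrank K C = n + c
  dist_of_le : hermDual q C ≤ C → δ = minWt (hermDual q C : Set (Fin n → K))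
  dist_of_not_le : ¬ hermDual q C ≤ C →
    δ = minWt ((hermDual q C : Set (Fin n → K)) \ (hermHull q C : Set (Fin n → K)))

/-- The code of length `n + 1` generated by the vectors `(x | 0)`, `x ∈ D`, and `(v | β)`. -/
def extendCode (D : Submodule K (Fin n → K)) (v : Fin n → K) (β : K) :
    Submodule K (Fin (n + 1) → K) :=
  Submodule.span K
    ((fun x : Fin n → K => (Fin.snoc (α := fun _ => K) x 0 : Fin (n + 1) → K)) '' D ∪
      {(Fin.snoc (α := fun _ => K) v β : Fin (n + 1) → K)})

end Classical

/-! ### Entanglement-assisted quantum codes -/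

section Quantum

/-- Computational basis labels of `m` qudits of dimension `q`. The state space `(ℂ^q)^{⊗ m}` is
`Qudits q m → ℂ`; the joint space of `m` qudits of the sender and `c` qudits of the receiver is
`Qudits q m × Qudits q c → ℂ`. -/
abbrev Qudits (q m : ℕ) : Type := Fin m → Fin q

/-- The state `q^{-c/2} ∑ b, |b⟩|b⟩`, that is, `c` maximally entangled pairs of qudits. -/
noncomputable def maxEntangled (q c : ℕ) : Qudits q c × Qudits q c → ℂ :=
  fun p => if p.1 = p.2 then ((Real.sqrt ((q : ℝ) ^ c))⁻¹ : ℝ) else 0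

/-- The encoding map `ψ ↦ (V ⊗ id) (ψ ⊗ Φ)`: `V` acts on the `κ` logical qudits and the sender's
halves of the `c` maximally entangled pairs `Φ`, and gives the `n` qudits that are sent. -/
noncomputable def eaEncode {q n κ c : ℕ} (V : Matrix (Qudits q n) (Qudits q κ × Qudits q c) ℂ) :
    (Qudits q κ → ℂ) →ₗ[ℂ] (Qudits q n × Qudits q c → ℂ) where
  toFun ψ := fun p => ∑ s, ∑ b, V p.1 (s, b) * (ψ s * maxEntangled q c (b, p.2))
  map_add' := by
    intro ψ φ
    funext p
    simp [add_mul, mul_add, Finset.sum_add_distrib]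
  map_smul' := by
    intro r ψ
    funext p
    simp only [Pi.smul_apply, smul_eq_mul, RingHom.id_apply, Finset.mul_sum]
    refine Finset.sum_congr rfl fun s _ => Finset.sum_congr rfl fun b _ => ?_
    ring

/-- The operator `E` on `n` qudits acts only on the positions in `T`: it is `M ⊗ id` for an
operator `M` on the qudits in `T`. -/
def ActsOn {q n : ℕ} (E : Matrix (Qudits q n) (Qudits q n) ℂ) (T : Finset (Fin n)) : Prop :=
  ∃ M : Matrix (T → Fin q) (T → Fin q) ℂ, ∀ x y : Qudits q n,
    ((∀ i, i ∉ T → x i = y i) → E x y = M (fun i => x i) (fun i => y i)) ∧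
    ((¬ ∀ i, i ∉ T → x i = y i) → E x y = 0)

/-- `(E ⊗ id) φ`: an error on the sender's `n` qudits; the receiver's `c` qudits are error free. -/
def applyError {q n c : ℕ} (E : Matrix (Qudits q n) (Qudits q n) ℂ)
    (φ : Qudits q n × Qudits q c → ℂ) : Qudits q n × Qudits q c → ℂ :=
  fun p => ∑ y, E p.1 y * φ (y, p.2)

/-- The Knill-Laflamme detection condition `⟨φ₁, (E ⊗ id) φ₂⟩ = lam * ⟨φ₁, φ₂⟩` on the code space
`Q` for the error `E`. -/
def DetectsWith {q n c : ℕ} (Q : Submodule ℂ (Qudits q n × Qudits q c → ℂ))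
    (E : Matrix (Qudits q n) (Qudits q n) ℂ) (lam : ℂ) : Prop :=
  ∀ φ₁ ∈ Q, ∀ φ₂ ∈ Q, star φ₁ ⬝ᵥ applyError E φ₂ = lam * (star φ₁ ⬝ᵥ φ₂)

/-- Every error on the positions in `T` is detected by the code `Q` with `κ` logical qudits.
For `κ = 0`, where the Knill-Laflamme condition is empty, the code has to be pure: traceless errors
on `T` have expectation zero, that is, the expectation of `E` is its normalized trace. -/
def DetectsErrorsOn {q n c : ℕ} (κ : ℕ) (Q : Submodule ℂ (Qudits q n × Qudits q c → ℂ))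
    (T : Finset (Fin n)) : Prop :=
  ∀ E : Matrix (Qudits q n) (Qudits q n) ℂ, ActsOn E T →
    ∃ lam : ℂ, DetectsWith Q E lam ∧ (κ = 0 → lam = E.trace / (q : ℂ) ^ n)

/-- `Q` is an `[[n, κ, δ; c]]_q` entanglement-assisted quantum error-correcting code.
* `encoder`: it consists of the states `(V ⊗ id) (ψ ⊗ Φ)`, with `ψ` a state of `κ` qudits, `Φ` the
  state of `c` maximally entangled pairs and `V` an isometry into `n` qudits. Such a `V` is a
  unitary on `n` qudits applied after adjoining `n - κ - c` ancillas in the state `|0⟩`.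
* `distance`: `δ` is the largest number such that all errors on fewer than `δ` of the `n` qudits
  are detected. The bound `d ≤ n + 1` gives the value `n + 1` to a code that detects
  all errors. -/
structure IsEAQECC (q n κ δ c : ℕ) (Q : Submodule ℂ (Qudits q n × Qudits q c → ℂ)) : Prop where
  encoder : ∃ V : Matrix (Qudits q n) (Qudits q κ × Qudits q c) ℂ,
    V.conjTranspose * V = 1 ∧ Q = LinearMap.range (eaEncode V)
  distance : IsGreatest
    {d : ℕ | d ≤ n + 1 ∧ ∀ T : Finset (Fin n), T.card < d → DetectsErrorsOn κ Q T} δ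

end Quantum

/-! ### The quadratic extension with `q ^ 2` elements: norm, trace, coordinates -/

section FieldLemmas

/-! Since `c ≥ 1`, the Hermitian form does not vanish on `C`, and polarization gives `v ∈ C` with
`⟨v, v⟩ ≠ 0`. The number `-⟨v, v⟩` lies in the subfield with `q` elements, where every element is a
norm `β ^ (q + 1)`. So `(v | β)` is isotropic, and it is orthogonal to all `(x | 0)` with `x ∈
C^⊥H`. Let `E` be the code spanned by these vectors and `C' = E^⊥H`. The form on `E` is that of
`C^⊥H` with one isotropic direction added to its radical, so the hull of `C'` is the hull of `C`
extended by `(v | β)` (`hermHull_hermDual_extendCode`). The length, `dim E` and the dimension of the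
hull each grow by one; hence `dim C' = dim C`, `c` drops by one and `κ` is unchanged. A word of `E`
is either a word of `C^⊥H` followed by `0` or a nonzero word of `C^⊥H + ⟨v⟩` followed by a nonzero
symbol, which gives the minimum weight.

The quantum code is a stabilizer code. The form on `C` has rank `c`, so there is a linear map `u`
from `C` onto `K ^ c` that reverses the sign of the form (`exists_anti_isometry`). The graph of `u`
is self-orthogonal of length `n + c`, its Weyl operators commute, and a joint eigenspace `Q` has
dimension `q ^ (n + c) / q ^ (2 k) = q ^ κ`. As `u` is onto, no nontrivial Weyl operator on the
receiver's side commutes with the stabilizer; the receiver's qudits are therefore maximally mixed,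
and `Q` is the range of an entanglement-assisted encoder (`exists_eaEncode_range`). A Weyl error on
the sender's side is detected with value `0` outside `C^⊥H`, acts as a nonzero scalar on the hull,
and is undetectable in between. Weyl operators span all local errors, so the distance is the
classical weight (`exists_isEAQECC`). -/

theorem finite_of_card_eq_sq {K : Type*} {q : ℕ} (hq : IsPrimePow q) (hK : Nat.card K = q ^ 2) : Finite K :=
  Nat.finite_of_card_ne_zero (by rw [hK]; exact pow_ne_zero _ hq.pos.ne')

variable {K : Type*} [Field K] {q : ℕ}

/-- The subfield with `q` elements of a field with `q ^ 2` elements. -/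
theorem exists_field_card_eq (hq : IsPrimePow q) (hK : Nat.card K = q ^ 2) :
    ∃ (F : Type) (_ : Field F) (_ : Fintype F) (_ : Algebra F K),
      Fintype.card F = q ∧ Module.finrank F K = 2 := by
  have := finite_of_card_eq_sq hq hK
  have := Fintype.ofFinite K
  obtain ⟨p, k, hp, hk, rfl⟩ := hq
  have hp' : p.Prime := hp.nat_prime
  have : Fact p.Prime := ⟨hp'⟩
  obtain ⟨r, hr⟩ := CharP.exists K
  obtain ⟨m, hrp, hm⟩ := FiniteField.card K r
  have hrp' : r = p := by
    rw [← Nat.card_eq_fintype_card, hK, ← pow_mul] at hm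
    have : p ∣ r ^ (m : ℕ) := hm ▸ dvd_pow_self p (by omega)
    exact ((Nat.prime_dvd_prime_iff_eq hp' hrp).1 (hp'.dvd_of_dvd_pow this)).symm
  subst hrp'
  let : Algebra (ZMod r) K := ZMod.algebra K r
  have h1 : Module.finrank (ZMod r) K = k * 2 := by
    have := FiniteField.pow_finrank_eq_natCard (k := K) r
    rw [hK, ← pow_mul] at this
    exact Nat.pow_right_injective hp'.two_le this
  obtain ⟨f⟩ := FiniteField.nonempty_algHom_of_finrank_dvd (F := ZMod r)
    (K := GaloisField r k) (L := K) (by rw [h1, GaloisField.finrank r hk.ne']; exact ⟨2, rfl⟩)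
  let : Algebra (GaloisField r k) K := f.toRingHom.toAlgebra
  let : Fintype (GaloisField r k) := Fintype.ofFinite _
  have hc : Fintype.card (GaloisField r k) = r ^ k := by
    rw [← Nat.card_eq_fintype_card, GaloisField.card r k hk.ne']
  refine ⟨GaloisField r k, inferInstance, inferInstance, inferInstance, hc, ?_⟩
  have h2 := Module.natCard_eq_pow_finrank (K := GaloisField r k) (V := K)
  rw [hK, GaloisField.card r k hk.ne'] at h2
  exact (Nat.pow_right_injective (Nat.one_lt_pow hk.ne' hp'.one_lt) h2).symm

theorem add_pow_card (hq : IsPrimePow q) (hK : Nat.card K = q ^ 2) (x y : K) :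
    (x + y) ^ q = x ^ q + y ^ q := by
  obtain ⟨F, _, _, _, hF, -⟩ := exists_field_card_eq hq hK
  rw [← hF]
  have := map_add (FiniteField.frobeniusAlgHom F K) x y
  simpa [FiniteField.coe_frobeniusAlgHom] using this

theorem pow_card_pow_card (hq : IsPrimePow q) (hK : Nat.card K = q ^ 2) (x : K) :
    (x ^ q) ^ q = x := by
  have := finite_of_card_eq_sq hq hK
  have := Fintype.ofFinite K
  rw [← pow_mul, ← sq, ← hK, Nat.card_eq_fintype_card, FiniteField.pow_card]

/-- The automorphism `x ↦ x ^ q` of the field with `q ^ 2` elements. -/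
def hermConj (hq : IsPrimePow q) (hK : Nat.card K = q ^ 2) : K ≃+* K where
  toFun x := x ^ q
  invFun x := x ^ q
  left_inv := pow_card_pow_card hq hK
  right_inv := pow_card_pow_card hq hK
  map_mul' x y := mul_pow x y q
  map_add' := add_pow_card hq hK

@[simp] theorem hermConj_apply (hq : IsPrimePow q) (hK : Nat.card K = q ^ 2) (x : K) :
    hermConj hq hK x = x ^ q := rfl

theorem algebraMap_trace_eq_add_pow {F : Type*} [Field F] [Fintype F] [Algebra F K] [Finite K]
    (h : Module.finrank F K = 2) (x : K) :
    algebraMap F K (Algebra.trace F K x) = x + x ^ Fintype.card F := by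
  rw [FiniteField.algebraMap_trace_eq_sum_pow, h]
  simp [Finset.sum_range_succ]

theorem algebraMap_norm_eq_pow_succ {F : Type*} [Field F] [Fintype F] [Algebra F K] [Finite K]
    (h : Module.finrank F K = 2) (x : K) :
    algebraMap F K (Algebra.norm F x) = x ^ (Fintype.card F + 1) := by
  rw [FiniteField.algebraMap_norm_eq_prod_pow, h]
  simp [Finset.prod_range_succ, pow_succ, mul_comm]

theorem exists_pow_succ_eq (hq : IsPrimePow q) (hK : Nat.card K = q ^ 2) {a : K}
    (ha : a ^ q = a) : ∃ b : K, b ^ (q + 1) = a := by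
  have := finite_of_card_eq_sq hq hK
  obtain ⟨F, _, _, _, hF, h2⟩ := exists_field_card_eq hq hK
  -- With `Tr t = 1`, the fixed element `a` equals `Tr (a * t)`, hence comes from `F`.
  obtain ⟨t, ht⟩ := Algebra.trace_surjective F K 1
  have hs : algebraMap F K (Algebra.trace F K (a * t)) = a := by
    rw [algebraMap_trace_eq_add_pow h2, mul_pow, hF, ha, ← mul_add, ← hF,
      ← algebraMap_trace_eq_add_pow h2, ht, map_one, mul_one]
  obtain ⟨b, hb⟩ := FiniteField.norm_surjective F K (Algebra.trace F K (a * t))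
  refine ⟨b, ?_⟩
  rw [← hF, ← algebraMap_norm_eq_pow_succ h2, hb, hs]

/-- Needed for polarization; `t = 1` would fail in characteristic two, surjectivity of the trace
does not. -/
theorem exists_add_pow_ne_zero (hq : IsPrimePow q) (hK : Nat.card K = q ^ 2) :
    ∃ t : K, t + t ^ q ≠ 0 := by
  have := finite_of_card_eq_sq hq hK
  obtain ⟨F, _, _, _, hF, h2⟩ := exists_field_card_eq hq hK
  obtain ⟨t, ht⟩ := Algebra.trace_surjective F K 1
  refine ⟨t, ?_⟩
  rw [← hF, ← algebraMap_trace_eq_add_pow h2, ht]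
  simp

/-- Coordinates `x = p₁ x + p₂ x * α` of the field with `q ^ 2` elements over its subfield, and a
form of `x * y ^ q` in these coordinates. -/
theorem exists_symplectic_coordinates (hq : IsPrimePow q) (hK : Nat.card K = q ^ 2) :
    ∃ (F : Type) (_ : Field F) (_ : Fintype F) (p : K ≃+ F × F),
      Fintype.card F = q ∧
      ∀ x y : K, (p (x * y ^ q)).2 = (p x).2 * (p y).1 - (p x).1 * (p y).2 := by
  have := finite_of_card_eq_sq hq hK
  obtain ⟨F, _, _, _, hF, h2⟩ := exists_field_card_eq hq hK
  have : Module.Finite F K := Module.finite_of_finrank_pos (by omega)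
  obtain ⟨α, hα⟩ := exists_linearIndependent_pair_of_one_lt_finrank (R := F) (M := K)
    (by omega) (one_ne_zero (α := K))
  let b := basisOfLinearIndependentOfCardEqFinrank hα (by simp [h2])
  let e := b.equivFun.trans (LinearEquiv.finTwoArrow F F)
  have he : ∀ r s : F, e (algebraMap F K r + algebraMap F K s * α) = (r, s) := by
    intro r s
    rw [← LinearEquiv.eq_symm_apply]
    simp [e, b, Fin.sum_univ_two, Module.Basis.equivFun_symm_apply, Algebra.smul_def]
  have hx : ∀ x : K, ∃ r s : F, x = algebraMap F K r + algebraMap F K s * α := by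
    intro x
    refine ⟨(e x).1, (e x).2, e.injective ?_⟩
    rw [he]
  refine ⟨F, inferInstance, inferInstance, e.toAddEquiv, hF, ?_⟩
  intro x y
  obtain ⟨r, s, rfl⟩ := hx x
  obtain ⟨r', s', rfl⟩ := hx y
  have hfix : ∀ t : F, (algebraMap F K t) ^ q = algebraMap F K t := fun t => by
    rw [← map_pow, ← hF, FiniteField.pow_card]
  -- Expand using `α ^ q = Tr α - α` and `α ^ (q + 1) = N α`; the coefficient of `α` is a symplectic
  -- form.
  have key : (algebraMap F K r + algebraMap F K s * α) *
      (algebraMap F K r' + algebraMap F K s' * α) ^ q =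
      algebraMap F K (r * r' + r * s' * Algebra.trace F K α + s * s' * Algebra.norm F α) +
        algebraMap F K (s * r' - r * s') * α := by
    rw [add_pow_card hq hK, mul_pow, hfix, hfix]
    simp only [map_add, map_mul, map_sub, algebraMap_trace_eq_add_pow h2,
      algebraMap_norm_eq_pow_succ h2, hF]
    ring
  change (e _).2 = (e _).2 * (e _).1 - (e _).1 * (e _).2
  rw [key, he, he, he]

end FieldLemmas

/-! ### Hermitian duality, anisotropic vectors and the anti-isometry -/

section HermitianForm

variable {K : Type*} [Field K] {n : ℕ} {q : ℕ}

theorem hermForm_add_left (x x' y : Fin n → K) :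
    hermForm q (x + x') y = hermForm q x y + hermForm q x' y := by
  simp [hermForm, add_mul, Finset.sum_add_distrib]

theorem hermForm_smul_left (a : K) (x y : Fin n → K) :
    hermForm q (a • x) y = a * hermForm q x y := by
  simp [hermForm, Finset.mul_sum, mul_assoc]

theorem hermForm_smul_right (a : K) (x y : Fin n → K) :
    hermForm q x (a • y) = a ^ q * hermForm q x y := by
  simp only [hermForm, Finset.mul_sum, Pi.smul_apply, smul_eq_mul, mul_pow]
  exact Finset.sum_congr rfl fun i _ => by ring

theorem hermForm_snoc (x y : Fin n → K) (a b : K) :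
    hermForm q (Fin.snoc (α := fun _ => K) x a : Fin (n + 1) → K)
      (Fin.snoc (α := fun _ => K) y b : Fin (n + 1) → K) = hermForm q x y + a * b ^ q := by
  simp [hermForm, Fin.sum_univ_castSucc]

theorem hermForm_cons (x y : Fin n → K) (a b : K) :
    hermForm q (Fin.cons (α := fun _ => K) a x : Fin (n + 1) → K)
      (Fin.cons (α := fun _ => K) b y : Fin (n + 1) → K) = a * b ^ q + hermForm q x y := by
  simp [hermForm, Fin.sum_univ_succ]

theorem mem_hermDual {C : Submodule K (Fin n → K)} {x : Fin n → K} :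
    x ∈ hermDual q C ↔ ∀ y ∈ C, hermForm q x y = 0 := Iff.rfl

theorem mem_hermHull {C : Submodule K (Fin n → K)} {x : Fin n → K} :
    x ∈ hermHull q C ↔ x ∈ C ∧ x ∈ hermDual q C := Iff.rfl

section

variable (hq : IsPrimePow q) (hK : Nat.card K = q ^ 2)
include hq hK

theorem hermForm_add_right (x y y' : Fin n → K) :
    hermForm q x (y + y') = hermForm q x y + hermForm q x y' := by
  simp [hermForm, add_pow_card hq hK, mul_add, Finset.sum_add_distrib]

theorem hermForm_pow (x y : Fin n → K) : hermForm q x y ^ q = hermForm q y x := by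
  rw [← hermConj_apply hq hK, hermForm, map_sum, hermForm]
  refine Finset.sum_congr rfl fun i _ => ?_
  rw [hermConj_apply, mul_pow, pow_card_pow_card hq hK, mul_comm]

theorem hermForm_eq_zero_symm {x y : Fin n → K} (h : hermForm q x y = 0) :
    hermForm q y x = 0 := by
  rw [← hermForm_pow hq hK, h, zero_pow hq.pos.ne']

/-- The map `y ↦ ⟨·, y⟩`, semilinear with respect to `x ↦ x ^ q`. -/
theorem exists_hermForm_toDual (n : ℕ) :
    ∃ f : (Fin n → K) →ₛₗ[(hermConj hq hK : K →+* K)] Module.Dual K (Fin n → K),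
      Function.Injective f ∧ ∀ x y, f y x = hermForm q x y := by
  refine ⟨{ toFun := fun y =>
              { toFun := fun x => hermForm q x y
                map_add' := fun x x' => hermForm_add_left x x' y
                map_smul' := fun a x => hermForm_smul_left a x y }
            map_add' := fun y y' => LinearMap.ext fun x => hermForm_add_right hq hK x y y'
            map_smul' := fun a y => LinearMap.ext fun x => hermForm_smul_right a x y }, ?_, ?_⟩
  · intro y y' h
    funext i
    have h1 : hermForm q (Pi.single i 1) y = hermForm q (Pi.single i 1) y' :=
      LinearMap.congr_fun h (Pi.single i 1)
    simp [hermForm, Pi.single_apply] at h1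
    exact (hermConj hq hK).injective h1
  · intro x y
    rfl

theorem finrank_add_finrank_hermDual (C : Submodule K (Fin n → K)) :
    Module.finrank K C + Module.finrank K (hermDual q C) = n := by
  obtain ⟨f, hf, hfx⟩ := exists_hermForm_toDual hq hK n
  have : RingHomInvPair (hermConj hq hK : K →+* K) ((hermConj hq hK).symm : K →+* K) :=
    RingHomInvPair.of_ringEquiv _
  have : RingHomInvPair ((hermConj hq hK).symm : K →+* K) (hermConj hq hK : K →+* K) :=
    RingHomInvPair.symm _ _
  have h1 : (C.map f).dualCoannihilator = hermDual q C := by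
    ext x
    simp [Submodule.mem_dualCoannihilator, mem_hermDual, hfx]
  have e := Submodule.equivMapOfInjective f hf C
  -- A bijection that is semilinear over a field automorphism preserves dimension.
  have h2 : Module.finrank K C = Module.finrank K (C.map f) := by
    have := lift_rank_eq_of_equiv_equiv (hermConj hq hK : K →+* K) e.toAddEquiv
      (hermConj hq hK).bijective (fun r m => e.map_smulₛₗ r m)
    simpa [Module.finrank] using congrArg Cardinal.toNat this
  rw [h2, ← h1, Subspace.finrank_add_finrank_dualCoannihilator_eq, Module.finrank_fin_fun]

theorem hermDual_hermDual (C : Submodule K (Fin n → K)) : hermDual q (hermDual q C) = C := by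
  have h1 := finrank_add_finrank_hermDual hq hK C
  have h2 := finrank_add_finrank_hermDual hq hK (hermDual q C)
  refine (Submodule.eq_of_le_of_finrank_eq ?_ (by omega)).symm
  exact fun x hx y hy => hermForm_eq_zero_symm hq hK (hy x hx)

/-- Polarization: if all `⟨v, v⟩` vanished on `C`, rescaling `x` so that `⟨z, y⟩ = t` and expanding
`⟨z + y, z + y⟩` would force `t + t ^ q = 0` for every `t`. -/
theorem exists_hermForm_self_ne_zero {C : Submodule K (Fin n → K)} {x y : Fin n → K}
    (hx : x ∈ C) (hy : y ∈ C) (hxy : hermForm q x y ≠ 0) : ∃ v ∈ C, hermForm q v v ≠ 0 := by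
  by_contra! h
  obtain ⟨t, ht⟩ := exists_add_pow_ne_zero hq hK
  apply ht
  set z := (t / hermForm q x y) • x with hz
  have hzC : z ∈ C := C.smul_mem _ hx
  have h1 : hermForm q z y = t := by
    rw [hz, hermForm_smul_left, div_mul_cancel₀ _ hxy]
  have h2 := h _ (C.add_mem hzC hy)
  rw [hermForm_add_left, hermForm_add_right hq hK, hermForm_add_right hq hK, h z hzC, h y hy,
    ← hermForm_pow hq hK z y, h1] at h2
  simpa using h2

theorem hermForm_self_pow (v : Fin n → K) : hermForm q v v ^ q = hermForm q v v :=
  hermForm_pow hq hK v v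

theorem exists_hermForm_self_ne_zero_of_finrank_lt {C : Submodule K (Fin n → K)}
    (h : Module.finrank K (hermHull q C) ≠ Module.finrank K C) :
    ∃ v ∈ C, hermForm q v v ≠ 0 := by
  have : ¬ C ≤ hermDual q C := fun hle => h (by rw [hermHull, inf_eq_left.2 hle])
  obtain ⟨x, hx, hx'⟩ := SetLike.not_le_iff_exists.1 this
  rw [mem_hermDual] at hx'
  push Not at hx'
  obtain ⟨y, hy, hxy⟩ := hx'
  exact exists_hermForm_self_ne_zero hq hK hx hy hxy

theorem exists_pow_succ_eq_neg (v : Fin n → K) :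
    ∃ β : K, hermForm q v v + β ^ (q + 1) = 0 := by
  have h : (-hermForm q v v) ^ q = -hermForm q v v := by
    have := (hermConj hq hK).map_neg (hermForm q v v)
    simpa [hermForm_self_pow hq hK] using this
  obtain ⟨β, hβ⟩ := exists_pow_succ_eq hq hK h
  exact ⟨β, by rw [hβ]; ring⟩

theorem exists_hermForm_self_eq_neg_one {C : Submodule K (Fin n → K)}
    (h : Module.finrank K (hermHull q C) ≠ Module.finrank K C) :
    ∃ v ∈ C, hermForm q v v = -1 := by
  obtain ⟨w, hw, hww⟩ := exists_hermForm_self_ne_zero_of_finrank_lt hq hK h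
  obtain ⟨β, hβ⟩ := exists_pow_succ_eq_neg hq hK w
  have hβ0 : β ≠ 0 := by
    rintro rfl
    simp at hβ
    exact hww hβ
  refine ⟨β⁻¹ • w, C.smul_mem _ hw, ?_⟩
  rw [hermForm_smul_left, hermForm_smul_right, eq_neg_of_add_eq_zero_left hβ, pow_succ, inv_pow]
  have := pow_ne_zero q hβ0
  field_simp

/-- A linear map carrying `-⟨x, y⟩` on `C` to the form of `K ^ c`. -/
theorem exists_anti_isometry (c : ℕ) : ∀ C : Submodule K (Fin n → K),
    c + Module.finrank K (hermHull q C) = Module.finrank K C →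
    ∃ u : (Fin n → K) →ₗ[K] (Fin c → K),
      (∀ x ∈ C, ∀ y ∈ C, hermForm q (u x) (u y) = -hermForm q x y) ∧
      ∀ t, ∃ x ∈ C, u x = t := by
  induction c with
  | zero =>
    intro C hC
    refine ⟨0, fun x hx y hy => ?_, fun t => ⟨0, C.zero_mem, Subsingleton.elim _ _⟩⟩
    have : hermHull q C = C := Submodule.eq_of_le_of_finrank_eq inf_le_left (by omega)
    have hx' : x ∈ hermHull q C := this.symm ▸ hx
    rw [hx'.2 y hy]
    simp [hermForm]
  | succ c ih =>
    intro C hC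
    obtain ⟨v, hvC, hvv⟩ := exists_hermForm_self_eq_neg_one hq hK (C := C) (by omega)
    let φ : (Fin n → K) →ₗ[K] K :=
      { toFun := fun x => hermForm q x v
        map_add' := fun x x' => hermForm_add_left x x' v
        map_smul' := fun a x => hermForm_smul_left a x v }
    have hφ : ∀ x, φ x = hermForm q x v := fun x => rfl
    -- Gram–Schmidt: split off `v`. Since `⟨v, v⟩ = -1`, the projection to the complement is `x +
    -- ⟨x, v⟩ v`, with a plus sign.
    set C₁ := C ⊓ LinearMap.ker φ with hC₁
    have hpr : ∀ x ∈ C, x + φ x • v ∈ C₁ := fun x hx =>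
      ⟨C.add_mem hx (C.smul_mem _ hvC), by simp [hφ v, hvv]⟩
    have hhull : hermHull q C₁ = hermHull q C := by
      ext x
      constructor
      · rintro ⟨hx, hx'⟩
        refine ⟨hx.1, fun y hy => ?_⟩
        have h1 := hx' _ (hpr y hy)
        have h2 : hermForm q x v = 0 := hx.2
        rwa [hermForm_add_right hq hK, hermForm_smul_right, h2, mul_zero, add_zero] at h1
      · rintro ⟨hx, hx'⟩
        exact ⟨⟨hx, hx' v hvC⟩, fun y hy => hx' y hy.1⟩
    have hrank : Module.finrank K C₁ + 1 = Module.finrank K C := by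
      have h1 := LinearMap.finrank_range_add_finrank_ker (φ.domRestrict C)
      have h2 : LinearMap.range (φ.domRestrict C) = ⊤ := by
        rw [LinearMap.range_eq_top]
        exact LinearMap.surjective (f := φ.domRestrict C) (fun h => by
          have := LinearMap.congr_fun h ⟨v, hvC⟩
          simp [hφ, hvv] at this)
      have h3 : Module.finrank K (LinearMap.ker (φ.domRestrict C)) = Module.finrank K C₁ := by
        have : C₁ = (LinearMap.ker (φ.domRestrict C)).map C.subtype := by
          ext x
          simp [hC₁]
          exact And.comm
        rw [this]
        exact (Submodule.finrank_map_subtype_eq _ _).symm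
      rw [h2, finrank_top, Module.finrank_self, h3] at h1
      omega
    obtain ⟨u₁, hu₁, hs⟩ := ih C₁ (by rw [hhull]; omega)
    -- The first coordinate `⟨x, v⟩` accounts for the line of `v`, the others for the projection to
    -- `C₁`.
    refine ⟨{ toFun := fun x => Fin.cons (α := fun _ => K) (φ x) (u₁ (x + φ x • v))
              map_add' := ?_
              map_smul' := ?_ }, ?_, ?_⟩
    · intro x y
      funext i
      refine Fin.cases ?_ (fun i => ?_) i
      · simp
      · simp [add_smul]; ring
    · intro a x
      funext i
      refine Fin.cases ?_ (fun i => ?_) i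
      · simp
      · simp; ring
    · intro x hx y hy
      change hermForm q (Fin.cons (α := fun _ => K) _ _ : Fin (c + 1) → K)
        (Fin.cons (α := fun _ => K) _ _ : Fin (c + 1) → K) = _
      rw [hermForm_cons, hu₁ _ (hpr x hx) _ (hpr y hy), hermForm_add_left,
        hermForm_add_right hq hK, hermForm_add_right hq hK, hermForm_smul_left,
        hermForm_smul_right, hermForm_smul_left, hermForm_smul_right, hvv,
        ← hermForm_pow hq hK y v, hφ, hφ]
      ring
    · intro t
      obtain ⟨x₁, hx₁, hx⟩ := hs (Fin.tail t)
      have h1 : φ (x₁ - t 0 • v) = t 0 := by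
        have : φ x₁ = 0 := hx₁.2
        rw [map_sub, map_smul, this, hφ, hvv]
        simp
      refine ⟨x₁ - t 0 • v, C.sub_mem hx₁.1 (C.smul_mem _ hvC), ?_⟩
      change (Fin.cons (α := fun _ => K) _ _ : Fin (c + 1) → K) = _
      rw [h1, sub_add_cancel, hx, Fin.cons_self_tail]

end

end HermitianForm

/-! ### Minimum weight with default value `n + 1` -/

section MinWt

variable {K : Type*} [Field K] {n : ℕ}

open scoped Classical in
theorem le_minWt_iff {S : Set (Fin n → K)} {d : ℕ} :
    d ≤ minWt S ↔ d ≤ n + 1 ∧ ∀ v ∈ S, v ≠ 0 → d ≤ hammingNorm v := by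
  have hne : ({w | ∃ v ∈ S, v ≠ 0 ∧ hammingNorm v = w} ∪ {n + 1}).Nonempty :=
    ⟨n + 1, Or.inr rfl⟩
  rw [minWt, le_csInf_iff'' hne]
  constructor
  · intro h
    exact ⟨h _ (Or.inr rfl), fun v hv hv0 => h _ (Or.inl ⟨v, hv, hv0, rfl⟩)⟩
  · rintro ⟨h, h'⟩ b (⟨v, hv, hv0, rfl⟩ | rfl)
    · exact h' v hv hv0
    · exact h

open scoped Classical in
theorem minWt_le {S : Set (Fin n → K)} {v : Fin n → K} (hv : v ∈ S) (hv0 : v ≠ 0) :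
    minWt S ≤ hammingNorm v :=
  (le_minWt_iff.1 le_rfl).2 v hv hv0

theorem minWt_le_succ (S : Set (Fin n → K)) : minWt S ≤ n + 1 :=
  (le_minWt_iff.1 le_rfl).1

open scoped Classical in
theorem exists_hammingNorm_eq_minWt {S : Set (Fin n → K)} {v : Fin n → K} (hv : v ∈ S)
    (hv0 : v ≠ 0) : ∃ w ∈ S, w ≠ 0 ∧ hammingNorm w = minWt S := by
  have hne : ({w | ∃ v ∈ S, v ≠ 0 ∧ hammingNorm v = w} ∪ {n + 1}).Nonempty :=
    ⟨n + 1, Or.inr rfl⟩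
  have hle : hammingNorm v ≤ n := hammingNorm_le_card_fintype.trans_eq (Fintype.card_fin n)
  rcases Nat.sInf_mem hne with h | h
  · exact h
  · have h1 := minWt_le hv hv0
    have h2 : minWt S = n + 1 := h
    omega

open scoped Classical in
theorem exists_hammingNorm_eq_minWt_of_le {S : Set (Fin n → K)} (h : minWt S ≤ n) :
    ∃ w ∈ S, w ≠ 0 ∧ hammingNorm w = minWt S := by
  by_cases hS : ∃ v ∈ S, v ≠ 0
  · obtain ⟨v, hv, hv0⟩ := hS
    exact exists_hammingNorm_eq_minWt hv hv0
  · push Not at hS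
    have : n + 1 ≤ minWt S := le_minWt_iff.2 ⟨le_rfl, fun v hv hv0 => absurd (hS v hv) hv0⟩
    omega

open scoped Classical in
theorem hammingNorm_snoc (x : Fin n → K) (a : K) :
    hammingNorm (Fin.snoc (α := fun _ => K) x a : Fin (n + 1) → K) =
      hammingNorm x + if a = 0 then 0 else 1 := by
  simp only [hammingNorm, Finset.card_filter, Fin.sum_univ_castSucc, Fin.snoc_castSucc,
    Fin.snoc_last, ite_not]

end MinWt

/-! ### The extended code, its weight and its hull -/

section ExtendCode

variable {K : Type*} [Field K] {n : ℕ} {q : ℕ}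

theorem snoc_zero_eq_zero_iff {x : Fin n → K} :
    (Fin.snoc (α := fun _ => K) x 0 : Fin (n + 1) → K) = 0 ↔ x = 0 := by
  constructor
  · intro h
    funext i
    simpa using congrFun h i.castSucc
  · rintro rfl
    funext i
    refine Fin.lastCases ?_ (fun i => ?_) i <;> simp

/-- The inclusion `x ↦ (x | 0)`. -/
def snocZero (K : Type*) [Field K] (n : ℕ) : (Fin n → K) →ₗ[K] (Fin (n + 1) → K) where
  toFun x := Fin.snoc (α := fun _ => K) x 0
  map_add' x y := by
    funext i
    refine Fin.lastCases ?_ (fun i => ?_) i <;> simp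
  map_smul' a x := by
    funext i
    refine Fin.lastCases ?_ (fun i => ?_) i <;> simp

theorem snocZero_apply (x : Fin n → K) :
    snocZero K n x = (Fin.snoc (α := fun _ => K) x 0 : Fin (n + 1) → K) := rfl

theorem snocZero_injective : Function.Injective (snocZero K n) := by
  rw [injective_iff_map_eq_zero]
  intro x hx
  exact snoc_zero_eq_zero_iff.1 hx

theorem extendCode_eq_sup (D : Submodule K (Fin n → K)) (v : Fin n → K) (β : K) :
    extendCode D v β =
      D.map (snocZero K n) ⊔ Submodule.span K {Fin.snoc (α := fun _ => K) v β} := by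
  rw [extendCode, Submodule.span_union]
  congr 1
  change Submodule.span K (D.map (snocZero K n) : Set (Fin (n + 1) → K)) = _
  exact Submodule.span_eq _

theorem mem_extendCode {D : Submodule K (Fin n → K)} {v : Fin n → K} {β : K}
    {z : Fin (n + 1) → K} :
    z ∈ extendCode D v β ↔
      ∃ x ∈ D, ∃ a : K, z = Fin.snoc (α := fun _ => K) (x + a • v) (a * β) := by
  have key : ∀ (x : Fin n → K) (a : K), snocZero K n x + a • Fin.snoc (α := fun _ => K) v β =
      (Fin.snoc (α := fun _ => K) (x + a • v) (a * β) : Fin (n + 1) → K) := by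
    intro x a
    funext i
    refine Fin.lastCases ?_ (fun i => ?_) i <;> simp [snocZero_apply]
  simp only [extendCode_eq_sup, Submodule.mem_sup, Submodule.mem_map,
    Submodule.mem_span_singleton]
  constructor
  · rintro ⟨_, ⟨x, hx, rfl⟩, _, ⟨a, rfl⟩, rfl⟩
    exact ⟨x, hx, a, key x a⟩
  · rintro ⟨x, hx, a, rfl⟩
    exact ⟨_, ⟨x, hx, rfl⟩, _, ⟨a, rfl⟩, key x a⟩

theorem snoc_zero_mem_extendCode_iff {D : Submodule K (Fin n → K)} {v : Fin n → K} {β : K}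
    (hβ : β ≠ 0) {x : Fin n → K} :
    (Fin.snoc (α := fun _ => K) x 0 : Fin (n + 1) → K) ∈ extendCode D v β ↔ x ∈ D := by
  rw [mem_extendCode]
  constructor
  · rintro ⟨y, hy, a, h⟩
    obtain ⟨h1, h2⟩ := Fin.snoc_inj.1 h
    have ha : a = 0 := by simpa [hβ, eq_comm] using h2
    rw [h1, ha, zero_smul, add_zero]
    exact hy
  · intro hx
    exact ⟨x, hx, 0, by simp⟩

theorem finrank_extendCode (D : Submodule K (Fin n → K)) (v : Fin n → K) {β : K} (hβ : β ≠ 0) :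
    Module.finrank K (extendCode D v β) = Module.finrank K D + 1 := by
  have hw : (Fin.snoc (α := fun _ => K) v β : Fin (n + 1) → K) ≠ 0 := fun h =>
    hβ (by simpa using congrFun h (Fin.last n))
  have hinf : D.map (snocZero K n) ⊓ Submodule.span K {Fin.snoc (α := fun _ => K) v β} = ⊥ := by
    rw [eq_bot_iff]
    rintro z ⟨⟨x, -, rfl⟩, hz⟩
    obtain ⟨a, ha⟩ := Submodule.mem_span_singleton.1 hz
    have h := congrFun ha (Fin.last n)
    have ha0 : a = 0 := by simpa [snocZero_apply, hβ] using h
    rw [← ha, ha0, zero_smul]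
    exact Submodule.zero_mem _
  have h := Submodule.finrank_sup_add_finrank_inf_eq (D.map (snocZero K n))
    (Submodule.span K {Fin.snoc (α := fun _ => K) v β})
  rw [hinf, finrank_bot, add_zero, finrank_span_singleton hw,
    ← (Submodule.equivMapOfInjective (snocZero K n) snocZero_injective D).finrank_eq] at h
  rw [extendCode_eq_sup, h]

/-- Pairing with `v` gives `a * ⟨v, v⟩`. Thus words of the extended code with nonzero last symbol
have weight at least `d₀ + 1`. -/
theorem add_smul_ne_zero {C : Submodule K (Fin n → K)} {v x : Fin n → K} (hv : v ∈ C)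
    (hvv : hermForm q v v ≠ 0) (hx : x ∈ hermDual q C) {a : K} (ha : a ≠ 0) : x + a • v ≠ 0 := by
  intro h
  have h1 : hermForm q (x + a • v) v = a * hermForm q v v := by
    rw [hermForm_add_left, hermForm_smul_left, hx v hv, zero_add]
  rw [h] at h1
  have h0 : hermForm q (0 : Fin n → K) v = 0 := by simp [hermForm]
  rw [h0] at h1
  exact mul_ne_zero ha hvv h1.symm

theorem minWt_extendCode {C : Submodule K (Fin n → K)} {v : Fin n → K} (hv : v ∈ C)
    (hvv : hermForm q v v ≠ 0) {β : K} (hβ : β ≠ 0) :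
    minWt (extendCode (hermDual q C) v β : Set (Fin (n + 1) → K)) =
      min (minWt (hermDual q C : Set (Fin n → K)))
        (minWt ((hermDual q C ⊔ Submodule.span K {v} : Submodule K (Fin n → K)) :
          Set (Fin n → K)) + 1) := by
  classical
  have hmem : ∀ {x : Fin n → K} {a : K}, x ∈ hermDual q C →
      x + a • v ∈ hermDual q C ⊔ Submodule.span K {v} := fun hx =>
    Submodule.add_mem_sup hx (Submodule.smul_mem _ _ (Submodule.mem_span_singleton_self v))
  have hv0 : v ≠ 0 := by
    rintro rfl
    simp [hermForm] at hvv
  apply le_antisymm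
  · rw [le_min_iff]
    constructor
    · by_cases h : minWt (hermDual q C : Set (Fin n → K)) ≤ n
      · obtain ⟨x, hx, hx0, hw⟩ := exists_hammingNorm_eq_minWt_of_le h
        rw [← hw]
        refine (minWt_le ((snoc_zero_mem_extendCode_iff hβ).2 hx)
          (snoc_zero_eq_zero_iff.not.2 hx0)).trans ?_
        rw [hammingNorm_snoc, if_pos rfl, add_zero]
      -- Here the dual has the default weight `n + 1`; the word `(v | β)` of length `n + 1` suffices
      -- for the bound.
      · have h1 : (Fin.snoc (α := fun _ => K) v β : Fin (n + 1) → K) ∈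
            extendCode (hermDual q C) v β :=
          mem_extendCode.2 ⟨0, Submodule.zero_mem _, 1, by simp⟩
        have h2 := minWt_le h1 (fun h => hβ (by simpa using congrFun h (Fin.last n)))
        have h3 := h2.trans hammingNorm_le_card_fintype
        rw [Fintype.card_fin] at h3
        omega
    · obtain ⟨w, hw, hw0, hwt⟩ := exists_hammingNorm_eq_minWt
        (S := ((hermDual q C ⊔ Submodule.span K {v} : Submodule K (Fin n → K)) :
          Set (Fin n → K))) (v := v)
        (Submodule.mem_sup_right (Submodule.mem_span_singleton_self v)) hv0
      rw [← hwt]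
      obtain ⟨x, hx, y, hy, rfl⟩ := Submodule.mem_sup.1 hw
      obtain ⟨a, rfl⟩ := Submodule.mem_span_singleton.1 hy
      have hne : (Fin.snoc (α := fun _ => K) (x + a • v) (a * β) : Fin (n + 1) → K) ≠ 0 := by
        intro h
        apply hw0
        funext i
        simpa using congrFun h i.castSucc
      refine (minWt_le (mem_extendCode.2 ⟨x, hx, a, rfl⟩) hne).trans ?_
      rw [hammingNorm_snoc]
      split_ifs <;> omega
  · refine le_minWt_iff.2 ⟨(min_le_left _ _).trans ((minWt_le_succ _).trans (by omega)), ?_⟩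
    intro z hz hz0
    obtain ⟨x, hx, a, rfl⟩ := mem_extendCode.1 hz
    by_cases ha : a = 0
    · subst ha
      rw [zero_mul, zero_smul, add_zero] at hz0 ⊢
      rw [hammingNorm_snoc, if_pos rfl, add_zero]
      exact (min_le_left _ _).trans (minWt_le hx (snoc_zero_eq_zero_iff.not.1 hz0))
    · rw [hammingNorm_snoc, if_neg (mul_ne_zero ha hβ)]
      exact (min_le_right _ _).trans (Nat.add_le_add_right
        (minWt_le (hmem hx) (add_smul_ne_zero hv hvv hx ha)) 1)

section

variable (hq : IsPrimePow q) (hK : Nat.card K = q ^ 2)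
include hq hK

/-- As `(v | β)` is isotropic and orthogonal to all `(x | 0)`, the form ignores the multiples of `(v
| β)`. So a word is in the radical exactly when its part in `C^⊥H` is orthogonal to `C^⊥H`, that is,
lies in `C`. -/
theorem hermHull_hermDual_extendCode {C : Submodule K (Fin n → K)} {v : Fin n → K} (hv : v ∈ C)
    {β : K} (hβ : hermForm q v v + β ^ (q + 1) = 0) :
    hermHull q (hermDual q (extendCode (hermDual q C) v β)) = extendCode (hermHull q C) v β := by
  ext z
  rw [mem_hermHull, hermDual_hermDual hq hK]
  have hform : ∀ (x y : Fin n → K) (a b : K), x ∈ hermDual q C → y ∈ hermDual q C →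
      hermForm q (Fin.snoc (α := fun _ => K) (x + a • v) (a * β) : Fin (n + 1) → K)
        (Fin.snoc (α := fun _ => K) (y + b • v) (b * β)) = hermForm q x y := by
    intro x y a b hx hy
    have hpow : β ^ q * β = -hermForm q v v := by
      rw [← pow_succ]; exact eq_neg_of_add_eq_zero_right hβ
    rw [hermForm_snoc, hermForm_add_left, hermForm_add_right hq hK, hermForm_add_right hq hK,
      hermForm_smul_right, hermForm_smul_left, hermForm_smul_left, hermForm_smul_right,
      hx v hv, hermForm_eq_zero_symm hq hK (hy v hv), mul_pow]
    linear_combination a * b ^ q * hpow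
  constructor
  · rintro ⟨hz, hz'⟩
    obtain ⟨x, hx, a, rfl⟩ := mem_extendCode.1 hz'
    refine mem_extendCode.2 ⟨x, ⟨?_, hx⟩, a, rfl⟩
    rw [← hermDual_hermDual hq hK C]
    intro y hy
    rw [← hform x y a 0 hx hy]
    exact hz _ (mem_extendCode.2 ⟨y, hy, 0, rfl⟩)
  · intro hz
    obtain ⟨x, hx, a, rfl⟩ := mem_extendCode.1 hz
    refine ⟨fun w hw => ?_, mem_extendCode.2 ⟨x, hx.2, a, rfl⟩⟩
    obtain ⟨y, hy, b, rfl⟩ := mem_extendCode.1 hw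
    rw [hform x y a b hx.2 hy]
    exact hermForm_eq_zero_symm hq hK (hy x hx.1)

theorem exists_isHermitianConstruction_extendCode {κ δ c : ℕ} {C : Submodule K (Fin n → K)}
    (hQ : IsHermitianConstruction q C κ δ c)
    (hpure : δ = minWt (hermDual q C : Set (Fin n → K))) (hc : 1 ≤ c) {v : Fin n → K}
    (hv : v ∈ C) (hvv : hermForm q v v ≠ 0) {β : K} (hβ0 : β ≠ 0)
    (hβ : hermForm q v v + β ^ (q + 1) = 0) :
    ∃ δ' ≤ δ, IsHermitianConstruction q (hermDual q (extendCode (hermDual q C) v β)) κ δ'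
      (c - 1) := by
  classical
  set E := extendCode (hermDual q C) v β with hE
  have hdd := hermDual_hermDual hq hK E
  have hhull : hermHull q (hermDual q E) = extendCode (hermHull q C) v β :=
    hermHull_hermDual_extendCode hq hK hv hβ
  have hr1 := finrank_add_finrank_hermDual hq hK C
  have hr2 := finrank_add_finrank_hermDual hq hK E
  have hr3 : Module.finrank K E = _ := finrank_extendCode (hermDual q C) v hβ0
  have hr4 := finrank_extendCode (hermHull q C) v hβ0
  have heb := hQ.ebits
  have hlo := hQ.logical
  refine ⟨if E ≤ hermDual q E then minWt (E : Set (Fin (n + 1) → K)) else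
    minWt ((E : Set (Fin (n + 1) → K)) \ (hermHull q (hermDual q E) : Set (Fin (n + 1) → K))),
    ?_, ?_, ?_, ?_, ?_⟩
  · split_ifs with h
    · rw [hE, minWt_extendCode hv hvv hβ0, hpure]
      exact min_le_left _ _
    -- If `C^⊥H` were its own hull, the extended code would be its own hull too. So `δ` is attained
    -- by some `y` outside the hull, and `(y | 0)` is again outside the hull.
    · have hD : ¬ hermDual q C ≤ C := by
        intro hD
        apply h
        have : hermHull q C = hermDual q C := inf_eq_right.2 hD
        rw [this] at hhull
        rw [← hE] at hhull
        exact hhull.symm.le.trans inf_le_left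
      have hδ := hQ.dist_of_not_le hD
      obtain ⟨x, hx, hx'⟩ := SetLike.not_le_iff_exists.1 hD
      obtain ⟨y, hy, hy0, hwt⟩ := exists_hammingNorm_eq_minWt
        (S := (hermDual q C : Set (Fin n → K)) \ (hermHull q C : Set (Fin n → K))) (v := x)
        ⟨hx, fun hh => hx' hh.1⟩ (fun h0 => hx' (h0 ▸ C.zero_mem))
      rw [hδ, ← hwt]
      have hmem : (Fin.snoc (α := fun _ => K) y 0 : Fin (n + 1) → K) ∈
          (E : Set (Fin (n + 1) → K)) \ (hermHull q (hermDual q E) : Set (Fin (n + 1) → K)) := by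
        refine ⟨(snoc_zero_mem_extendCode_iff hβ0).2 hy.1, ?_⟩
        rw [hhull]
        exact fun hh => hy.2 ((snoc_zero_mem_extendCode_iff hβ0).1 hh)
      refine (minWt_le hmem (snoc_zero_eq_zero_iff.not.2 hy0)).trans ?_
      rw [hammingNorm_snoc, if_pos rfl, add_zero]
  · rw [hhull]
    omega
  · omega
  · rw [hdd]
    intro h
    rw [if_pos h]
  · rw [hdd]
    intro h
    rw [if_neg h]

end

end ExtendCode

/-! ### Abstract Weyl systems and their stabilizer codes -/

section WeylSystem

open Matrix

/-- A projective unitary representation of the group `Z` on `X → ℂ` in which all operators except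
`op 0 = 1` have trace zero. -/
structure WeylSystem (Z X : Type*) [AddCommGroup Z] [Fintype X] [DecidableEq X] where
  op : Z → Matrix X X ℂ
  cocycle : Z → Z → ℂ
  op_zero : op 0 = 1
  op_mul : ∀ s t, op s * op t = cocycle s t • op (s + t)
  op_unitary : ∀ s, (op s)ᴴ * op s = 1
  trace_op : ∀ s, s ≠ 0 → (op s).trace = 0

namespace WeylSystem

variable {Z X : Type*} [AddCommGroup Z] [Fintype X] [DecidableEq X] (W : WeylSystem Z X)

theorem op_ne_zero [Nonempty X] (s : Z) : W.op s ≠ 0 := by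
  intro h
  have := W.op_unitary s
  rw [h, Matrix.mul_zero] at this
  exact zero_ne_one this

theorem isUnit_op (s : Z) : IsUnit (W.op s) :=
  IsUnit.of_mul_eq_one_right _ (W.op_unitary s)

theorem cocycle_ne_zero [Nonempty X] (s t : Z) : W.cocycle s t ≠ 0 := by
  intro h
  have h1 := W.op_mul s t
  rw [h, zero_smul] at h1
  exact ((W.isUnit_op s).mul (W.isUnit_op t)).ne_zero h1

theorem commute_op_iff [Nonempty X] (s t : Z) :
    Commute (W.op s) (W.op t) ↔ W.cocycle s t = W.cocycle t s := by
  rw [commute_iff_eq, W.op_mul, W.op_mul, add_comm t s]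
  exact ⟨fun h => smul_left_injective ℂ (W.op_ne_zero (s + t)) h, fun h => by rw [h]⟩

theorem star_mulVec_dotProduct_mulVec (s : Z) (φ χ : X → ℂ) :
    star (W.op s *ᵥ φ) ⬝ᵥ (W.op s *ᵥ χ) = star φ ⬝ᵥ χ := by
  rw [star_mulVec, ← dotProduct_mulVec, mulVec_mulVec, W.op_unitary, one_mulVec]

theorem op_pow (s : Z) (m : ℕ) : ∃ c : ℂ, W.op s ^ m = c • W.op (m • s) := by
  induction m with
  | zero => exact ⟨1, by simp [W.op_zero]⟩
  | succ m ih =>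
    obtain ⟨c, hc⟩ := ih
    exact ⟨c * W.cocycle (m • s) s, by rw [pow_succ, hc, smul_mul, W.op_mul, smul_smul, succ_nsmul]⟩

/-- A power of the operator is a nonzero scalar `c`, and `X ^ N - c` is separable over `ℂ`. Hence
generalized eigenvectors are eigenvectors. -/
theorem isSemisimple_op [Finite Z] [Nonempty X] (s : Z) :
    Module.End.IsSemisimple (toLin' (W.op s)) := by
  obtain ⟨c, hc⟩ := W.op_pow s (Nat.card Z)
  rw [card_nsmul_eq_zero', W.op_zero] at hc
  have hc0 : c ≠ 0 := by
    rintro rfl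
    rw [zero_smul] at hc
    exact ((W.isUnit_op s).pow _).ne_zero hc
  have hZ : ((Nat.card Z : ℕ) : ℂ) ≠ 0 := Nat.cast_ne_zero.2 Nat.card_pos.ne'
  refine Module.End.isSemisimple_of_squarefree_aeval_eq_zero
    (Polynomial.separable_X_pow_sub_C c hZ hc0).squarefree ?_
  rw [map_sub, map_pow, Polynomial.aeval_X, Polynomial.aeval_C, ← toLin'_pow, hc, map_smul,
    toLin'_one, sub_eq_zero]
  rfl

theorem exists_joint_eigenvector [Finite Z] [Nonempty X] (S : AddSubgroup Z)
    (hS : ∀ s ∈ S, ∀ t ∈ S, Commute (W.op s) (W.op t)) :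
    ∃ (lam : S → ℂ) (φ : X → ℂ), φ ≠ 0 ∧ ∀ s : S, W.op s *ᵥ φ = lam s • φ := by
  have htop := Module.End.iSup_iInf_maxGenEigenspace_eq_top_of_iSup_maxGenEigenspace_eq_top_of_commute
    (fun s : S => (toLin' (W.op s) : Module.End ℂ (X → ℂ)))
    (fun s t _ => by
      have h := hS s s.2 t t.2
      rw [commute_iff_eq] at h
      change toLin' _ * toLin' _ = toLin' _ * toLin' _
      rw [Module.End.mul_eq_comp, Module.End.mul_eq_comp, ← toLin'_mul, ← toLin'_mul, h])
    (fun s => Module.End.iSup_maxGenEigenspace_eq_top _)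
  have hex : ∃ lam : S → ℂ,
      (⨅ s : S, Module.End.maxGenEigenspace (toLin' (W.op s)) (lam s)) ≠ ⊥ := by
    by_contra! h
    simp only [h, iSup_bot] at htop
    exact bot_ne_top htop
  obtain ⟨lam, hlam⟩ := hex
  obtain ⟨φ, hφ, hφ0⟩ := Submodule.exists_mem_ne_zero_of_ne_bot hlam
  refine ⟨lam, φ, hφ0, fun s => ?_⟩
  have h1 := (Submodule.mem_iInf _).1 hφ s
  rw [(W.isSemisimple_op (s : Z)).isFinitelySemisimple.maxGenEigenspace_eq_eigenspace,
    Module.End.mem_eigenspace_iff] at h1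
  simpa using h1

/-- The joint eigenspace of the operators of `S`. -/
def stabilizerCode (S : AddSubgroup Z) (lam : S → ℂ) : Submodule ℂ (X → ℂ) where
  carrier := {φ | ∀ s : S, W.op s *ᵥ φ = lam s • φ}
  zero_mem' s := by simp
  add_mem' h h' s := by rw [mulVec_add, h s, h' s, smul_add]
  smul_mem' a φ h s := by rw [mulVec_smul, h s, smul_comm]

theorem mem_stabilizerCode {S : AddSubgroup Z} {lam : S → ℂ} {φ : X → ℂ} :
    φ ∈ W.stabilizerCode S lam ↔ ∀ s : S, W.op s *ᵥ φ = lam s • φ := Iff.rfl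

/-- The systems of eigenvalues of the operators of `S`. -/
structure IsWeight (S : AddSubgroup Z) (lam : S → ℂ) : Prop where
  map_zero : lam 0 = 1
  mul : ∀ s t, lam s * lam t = W.cocycle s t * lam (s + t)
  star_mul_self : ∀ s, star (lam s) * lam s = 1

/-- All relations are read off from the action on one joint eigenvector; unitarity gives the
modulus. -/
theorem exists_isWeight [Finite Z] [Nonempty X] (S : AddSubgroup Z)
    (hS : ∀ s ∈ S, ∀ t ∈ S, Commute (W.op s) (W.op t)) :
    ∃ lam : S → ℂ, W.IsWeight S lam := by
  open scoped ComplexOrder in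
  obtain ⟨lam, φ, hφ0, hφ⟩ := W.exists_joint_eigenvector S hS
  have hinj : ∀ {a b : ℂ}, a • φ = b • φ → a = b := fun h => smul_left_injective ℂ hφ0 h
  refine ⟨lam, hinj ?_, fun s t => hinj ?_, fun s => ?_⟩
  · rw [← hφ 0, one_smul, ZeroMemClass.coe_zero, W.op_zero, one_mulVec]
  · rw [mul_comm, mul_smul, ← hφ s, ← mulVec_smul, ← hφ t, mulVec_mulVec, W.op_mul, smul_mulVec,
      mul_smul, ← hφ (s + t), AddSubgroup.coe_add]
  · have h := W.star_mulVec_dotProduct_mulVec s φ φ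
    rw [hφ, star_smul, smul_dotProduct, dotProduct_smul, smul_smul, smul_eq_mul] at h
    exact mul_right_cancel₀ (dotProduct_star_self_eq_zero.not.2 hφ0) (h.trans (one_mul _).symm)

variable {S : AddSubgroup Z} {lam : S → ℂ}

/-- Conjugating `op x` by `op s` multiplies it by a scalar other than `1`, yet leaves the inner
product unchanged because `op s` has the same unit eigenvalue on `φ` and `χ`. -/
theorem dotProduct_op_eq_zero [Nonempty X] (hlam : W.IsWeight S lam) {x : Z} {s : S}
    (h : ¬ Commute (W.op s) (W.op x)) {φ χ : X → ℂ} (hφ : φ ∈ W.stabilizerCode S lam)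
    (hχ : χ ∈ W.stabilizerCode S lam) : star φ ⬝ᵥ (W.op x *ᵥ χ) = 0 := by
  have h1 := W.star_mulVec_dotProduct_mulVec s φ (W.op x *ᵥ χ)
  have h2 : W.op s * W.op x = (W.cocycle s x / W.cocycle x s) • (W.op x * W.op s) := by
    rw [W.op_mul, W.op_mul, smul_smul, div_mul_cancel₀ _ (W.cocycle_ne_zero _ _), add_comm x]
  rw [mulVec_mulVec, h2, smul_mulVec, ← mulVec_mulVec, W.mem_stabilizerCode.1 hφ s,
    W.mem_stabilizerCode.1 hχ s, mulVec_smul, star_smul, smul_dotProduct, dotProduct_smul,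
    dotProduct_smul, smul_eq_mul, smul_eq_mul, smul_eq_mul] at h1
  have h3 : (W.cocycle s x / W.cocycle x s - 1) * (star φ ⬝ᵥ (W.op x *ᵥ χ)) = 0 := by
    linear_combination h1 - (W.cocycle s x / W.cocycle x s * (star φ ⬝ᵥ (W.op x *ᵥ χ))) *
      hlam.star_mul_self s
  refine (mul_eq_zero.1 h3).resolve_left fun h4 => h ?_
  rw [W.commute_op_iff]
  exact (div_eq_one_iff_eq (W.cocycle_ne_zero _ _)).1 (sub_eq_zero.1 h4)

/-- The projection onto the joint eigenspace. -/
noncomputable def stabilizerProj (S : AddSubgroup Z) (lam : S → ℂ) : Matrix X X ℂ :=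
  (Nat.card S : ℂ)⁻¹ • ∑ᶠ s : S, star (lam s) • W.op s

theorem stabilizerProj_eq [Fintype S] :
    W.stabilizerProj S lam = (Nat.card S : ℂ)⁻¹ • ∑ s : S, star (lam s) • W.op s := by
  rw [stabilizerProj, finsum_eq_sum_of_fintype]

variable [Finite Z]

theorem op_mul_stabilizerProj (hlam : W.IsWeight S lam) (t : S) :
    W.op t * W.stabilizerProj S lam = lam t • W.stabilizerProj S lam := by
  have := Fintype.ofFinite S
  rw [stabilizerProj_eq, mul_smul_comm, smul_comm]
  congr 1
  rw [Finset.mul_sum, Finset.smul_sum, ← Equiv.sum_comp (Equiv.addLeft t)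
    (fun s => lam t • star (lam s) • W.op s)]
  refine Finset.sum_congr rfl fun s _ => ?_
  rw [mul_smul_comm, W.op_mul, smul_smul, smul_smul, Equiv.coe_addLeft, AddSubgroup.coe_add]
  congr 1
  have h1 := hlam.mul t s
  have h2 := hlam.star_mul_self s
  have h3 := hlam.star_mul_self (t + s)
  -- Both eigenvalues have modulus one, so conjugation inverts them in the weight relation.
  calc star (lam s) * W.cocycle t s
      = star (lam s) * (W.cocycle t s * lam (t + s)) * star (lam (t + s)) := by
        linear_combination (-star (lam s) * W.cocycle t s) * h3
    _ = lam t * star (lam (t + s)) := by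
        rw [← h1]
        linear_combination (lam t * star (lam (t + s))) * h2

theorem isProj_stabilizerProj (hlam : W.IsWeight S lam) :
    LinearMap.IsProj (W.stabilizerCode S lam) (toLin' (W.stabilizerProj S lam)) where
  map_mem φ s := by
    rw [toLin'_apply, mulVec_mulVec, W.op_mul_stabilizerProj hlam, smul_mulVec]
  map_id φ hφ := by
    have := Fintype.ofFinite S
    rw [toLin'_apply, stabilizerProj_eq, smul_mulVec, sum_mulVec]
    have h : ∀ s : S, (star (lam s) • W.op s) *ᵥ φ = φ := fun s => by
      rw [smul_mulVec, W.mem_stabilizerCode.1 hφ s, smul_smul, hlam.star_mul_self, one_smul]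
    simp only [h]
    rw [Finset.sum_const, Finset.card_univ, ← Nat.card_eq_fintype_card, ← Nat.cast_smul_eq_nsmul ℂ,
      smul_smul, inv_mul_cancel₀ (Nat.cast_ne_zero.2 Nat.card_pos.ne'), one_smul]

/-- The dimension is the trace of the projection, to which only the term of `0` contributes. -/
theorem finrank_stabilizerCode (hlam : W.IsWeight S lam) :
    Module.finrank ℂ (W.stabilizerCode S lam) * Nat.card S = Fintype.card X := by
  have := Fintype.ofFinite S
  have h := (W.isProj_stabilizerProj hlam).trace
  rw [trace_toLin'_eq, stabilizerProj_eq, trace_smul, trace_sum, Finset.sum_eq_single 0] at h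
  · rw [ZeroMemClass.coe_zero, W.op_zero, hlam.map_zero, star_one, one_smul, trace_one,
      smul_eq_mul, inv_mul_eq_iff_eq_mul₀ (Nat.cast_ne_zero.2 Nat.card_pos.ne')] at h
    rw [mul_comm]
    exact_mod_cast h.symm
  · intro s _ hs
    rw [trace_smul, W.trace_op s (by simpa using hs), smul_zero]
  · simp

/-- The operator `op x` preserves the code, so it would act there as the scalar `a`. Its product
with the projection has trace zero since `x + s ≠ 0` for `s ∈ S`; this forces `a = 0`, against
unitarity. -/
theorem not_exists_dotProduct_op_eq [Nonempty X] (hlam : W.IsWeight S lam) {x : Z} (hx : x ∉ S)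
    (hcomm : ∀ s ∈ S, Commute (W.op s) (W.op x)) (a : ℂ) :
    ¬ ∀ φ ∈ W.stabilizerCode S lam, ∀ χ ∈ W.stabilizerCode S lam,
      star φ ⬝ᵥ (W.op x *ᵥ χ) = a * (star φ ⬝ᵥ χ) := by
  open scoped ComplexOrder in
  intro h
  have := Fintype.ofFinite S
  have h1 : ∀ χ ∈ W.stabilizerCode S lam, W.op x *ᵥ χ = a • χ := by
    intro χ hχ
    have hx' : W.op x *ᵥ χ ∈ W.stabilizerCode S lam := fun s => by
      rw [mulVec_mulVec, (hcomm s s.2).eq, ← mulVec_mulVec, W.mem_stabilizerCode.1 hχ s,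
        mulVec_smul]
    have hd := Submodule.sub_mem _ hx' (Submodule.smul_mem _ a hχ)
    have h2 := h _ hd χ hχ
    rw [← sub_eq_zero, ← dotProduct_star_self_eq_zero (R := ℂ)]
    rw [dotProduct_sub, dotProduct_smul, h2, smul_eq_mul, sub_self]
  have h2 : W.op x * W.stabilizerProj S lam = a • W.stabilizerProj S lam := by
    apply toLin'.injective
    refine LinearMap.ext fun χ => ?_
    rw [toLin'_apply, toLin'_apply, smul_mulVec, ← mulVec_mulVec]
    exact h1 _ ((W.isProj_stabilizerProj hlam).map_mem χ)
  have h3 : (W.op x * W.stabilizerProj S lam).trace = 0 := by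
    rw [stabilizerProj_eq, mul_smul_comm, trace_smul, Finset.mul_sum, trace_sum,
      Finset.sum_eq_zero, smul_zero]
    intro s _
    have : x + s ≠ 0 := fun h0 => hx (by
      rw [eq_neg_of_add_eq_zero_left h0]; exact S.neg_mem s.2)
    rw [mul_smul_comm, W.op_mul, trace_smul, trace_smul, W.trace_op _ this, smul_zero, smul_zero]
  have hrank := W.finrank_stabilizerCode hlam
  have hpos : Module.finrank ℂ (W.stabilizerCode S lam) ≠ 0 := by
    intro h0
    rw [h0, zero_mul] at hrank
    exact Fintype.card_ne_zero hrank.symm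
  rw [h2, trace_smul, ← trace_toLin'_eq, (W.isProj_stabilizerProj hlam).trace, smul_eq_mul,
    mul_eq_zero] at h3
  have ha : a = 0 := h3.resolve_right (Nat.cast_ne_zero.2 hpos)
  subst ha
  have hb : W.stabilizerCode S lam ≠ ⊥ := fun h0 => hpos (by rw [h0, finrank_bot])
  obtain ⟨χ, hχ, hχ0⟩ := Submodule.exists_mem_ne_zero_of_ne_bot hb
  have h4 := W.star_mulVec_dotProduct_mulVec x χ χ
  rw [h1 χ hχ, zero_smul, dotProduct_zero] at h4
  exact hχ0 (dotProduct_star_self_eq_zero.1 h4.symm)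

end WeylSystem

end WeylSystem

open Matrix Kronecker

/-! ### Weyl operators on qudits -/

section WeylOperators

variable {K F L J : Type*} [AddCommGroup K] [Field F]

/-- Translation of labels by the first coordinates of `z`. -/
def weylShift (p : K ≃+ F × F) (e : L ≃ F) (z : J → K) (x : J → L) : J → L :=
  fun j => e.symm (e (x j) - (p (z j)).1)

theorem weylShift_zero (p : K ≃+ F × F) (e : L ≃ F) (x : J → L) :
    weylShift p e 0 x = x := by
  funext j
  simp [weylShift]

theorem weylShift_weylShift (p : K ≃+ F × F) (e : L ≃ F) (z w : J → K) (x : J → L) :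
    weylShift p e w (weylShift p e z x) = weylShift p e (z + w) x := by
  funext j
  simp [weylShift, sub_sub]

theorem weylShift_injective (p : K ≃+ F × F) (e : L ≃ F) (z : J → K) :
    Function.Injective (weylShift p e z) := by
  intro x y h
  funext j
  have := congrFun h j
  simpa [weylShift] using this

variable [Fintype J]

/-- The pairing of the second coordinates of `z` with a label. -/
def weylPhase (p : K ≃+ F × F) (e : L ≃ F) (z : J → K) (x : J → L) : F :=
  ∑ j, (p (z j)).2 * e (x j)

theorem weylPhase_add (p : K ≃+ F × F) (e : L ≃ F) (z w : J → K) (x : J → L) :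
    weylPhase p e (z + w) x = weylPhase p e z x + weylPhase p e w x := by
  simp [weylPhase, add_mul, Finset.sum_add_distrib]

theorem weylPhase_weylShift (p : K ≃+ F × F) (e : L ≃ F) (z w : J → K) (x : J → L) :
    weylPhase p e w (weylShift p e z x) =
      weylPhase p e w x - ∑ j, (p (w j)).2 * (p (z j)).1 := by
  simp [weylPhase, weylShift, mul_sub, Finset.sum_sub_distrib]

variable [DecidableEq L]

/-- The Weyl operator: multiplication by a character after a translation. -/
def weylMatrix (p : K ≃+ F × F) (ψ : AddChar F ℂ) (e : L ≃ F) (z : J → K) :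
    Matrix (J → L) (J → L) ℂ :=
  Matrix.of fun x y => if y = weylShift p e z x then ψ (weylPhase p e z x) else 0

theorem weylMatrix_apply (p : K ≃+ F × F) (ψ : AddChar F ℂ) (e : L ≃ F) (z : J → K)
    (x y : J → L) : weylMatrix p ψ e z x y =
      if y = weylShift p e z x then ψ (weylPhase p e z x) else 0 := rfl

variable [Fintype F] [Fintype L] [DecidableEq J]

theorem sum_addChar_dotProduct_eq_zero {ψ : AddChar F ℂ} (hψ : ψ ≠ 1) {b : J → F} (hb : b ≠ 0) :
    ∑ h : J → F, ψ (∑ j, b j * h j) = 0 := by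
  obtain ⟨i, hi⟩ := Function.ne_iff.1 hb
  obtain ⟨t, ht⟩ := AddChar.ne_one_iff.1 hψ
  let f : (J → F) →+ F :=
    { toFun := fun h => ∑ j, b j * h j
      map_zero' := by simp
      map_add' := fun h h' => by simp [mul_add, Finset.sum_add_distrib] }
  refine AddChar.sum_eq_zero_of_ne_one (ψ := ψ.compAddMonoidHom f) (AddChar.ne_one_iff.2
    ⟨Pi.single i ((b i)⁻¹ * t), ?_⟩)
  have : f (Pi.single i ((b i)⁻¹ * t)) = t := by
    change ∑ j, b j * (Pi.single i ((b i)⁻¹ * t) : J → F) j = t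
    rw [Finset.sum_eq_single i]
    · rw [Pi.single_eq_same, mul_inv_cancel_left₀ hi]
    · intro j _ hj
      rw [Pi.single_eq_of_ne hj, mul_zero]
    · simp
  rw [AddChar.compAddMonoidHom_apply, this]
  exact ht

/-- A nontrivial translation has no diagonal entries; without translation the trace is a nontrivial
character sum. -/
theorem trace_weylMatrix (p : K ≃+ F × F) {ψ : AddChar F ℂ} (hψ : ψ ≠ 1) (e : L ≃ F)
    {z : J → K} (hz : z ≠ 0) : (weylMatrix p ψ e z).trace = 0 := by
  simp only [trace, diag_apply, weylMatrix_apply]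
  by_cases h : ∀ j, (p (z j)).1 = 0
  · have h1 : ∀ x : J → L, x = weylShift p e z x := fun x => by
      funext j
      simp [weylShift, h j]
    have h2 : (fun j => (p (z j)).2) ≠ 0 := fun h2 => hz (by
      funext j
      exact (map_eq_zero_iff p p.injective).1 (Prod.ext (h j) (congrFun h2 j)))
    rw [← sum_addChar_dotProduct_eq_zero hψ h2,
      ← Equiv.sum_comp (Equiv.arrowCongr (Equiv.refl J) e)]
    refine Finset.sum_congr rfl fun x _ => ?_
    rw [if_pos (h1 x)]
    rfl
  · push Not at h
    obtain ⟨j, hj⟩ := h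
    refine Finset.sum_eq_zero fun x _ => if_neg fun hx => hj ?_
    have := congrFun hx j
    rw [weylShift, Equiv.eq_symm_apply] at this
    rw [eq_comm, sub_eq_self] at this
    exact this

variable (J) in
/-- The Weyl operators on qudits with labels in `L ≃ F` at the positions in `J`. -/
noncomputable def weylSystem (p : K ≃+ F × F) {ψ : AddChar F ℂ} (hψ : ψ ≠ 1) (e : L ≃ F) :
    WeylSystem (J → K) (J → L) where
  op := weylMatrix p ψ e
  cocycle z w := ψ (-∑ j, (p (w j)).2 * (p (z j)).1)
  op_zero := by
    ext x y
    rw [weylMatrix_apply, weylShift_zero, one_apply]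
    simp [weylPhase, eq_comm]
  op_mul z w := by
    ext x y
    simp only [mul_apply, weylMatrix_apply, Matrix.smul_apply, ite_mul, zero_mul, Finset.sum_ite_eq',
      Finset.mem_univ, if_true, weylShift_weylShift, smul_eq_mul]
    rw [mul_ite, mul_ite, mul_zero, mul_zero, ← AddChar.map_add_eq_mul, ← AddChar.map_add_eq_mul,
      weylPhase_weylShift, weylPhase_add]
    congr 2
    ring
  op_unitary z := by
    rw [mul_eq_one_comm]
    ext x y
    simp only [mul_apply, conjTranspose_apply, weylMatrix_apply, ite_mul, zero_mul]
    rw [Finset.sum_ite_eq_of_mem' _ _ _ (Finset.mem_univ _), one_apply]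
    by_cases h : x = y
    · subst h
      rw [if_pos rfl, if_pos rfl, ← starRingEnd_apply, ← AddChar.map_neg_eq_conj,
        ← AddChar.map_add_eq_mul, add_neg_cancel, AddChar.map_zero_eq_one]
    · rw [if_neg h, if_neg fun h' => h (weylShift_injective p e z h'), star_zero, mul_zero]
  trace_op z hz := trace_weylMatrix p hψ e hz

/-- Fourier inversion: a matrix unit is an average, over all phases `b`, of Weyl operators with one
fixed translation. -/
theorem span_range_weylMatrix (p : K ≃+ F × F) {ψ : AddChar F ℂ} (hψ : ψ ≠ 1) (e : L ≃ F) :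
    Submodule.span ℂ (Set.range (weylMatrix p ψ e : (J → K) → Matrix (J → L) (J → L) ℂ)) = ⊤ := by
  rw [eq_top_iff]
  rintro M -
  rw [matrix_eq_sum_single M]
  refine Submodule.sum_mem _ fun x _ => Submodule.sum_mem _ fun y _ => ?_
  have hsm : single x y (M x y) = M x y • (single x y 1 : Matrix (J → L) (J → L) ℂ) := by
    rw [smul_single, smul_eq_mul, mul_one]
  rw [hsm]
  refine Submodule.smul_mem _ _ ?_
  -- The translation by `x - y` moves the label `x` to `y`.
  let Z : (J → F) → J → K := fun b j => p.symm (e (x j) - e (y j), b j)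
  have key : (single x y 1 : Matrix (J → L) (J → L) ℂ) = (Fintype.card (J → F) : ℂ)⁻¹ •
      ∑ b : J → F, ψ (-∑ j, b j * e (x j)) • weylMatrix p ψ e (Z b) := by
    ext u v
    have h1 : ∀ b, weylShift p e (Z b) u = fun j => e.symm (e (u j) - (e (x j) - e (y j))) := by
      intro b
      funext j
      simp [weylShift, Z]
    have h2 : ∀ b, ψ (-∑ j, b j * e (x j)) * ψ (weylPhase p e (Z b) u) =
        ψ (∑ j, (e (u j) - e (x j)) * b j) := by
      intro b
      rw [← AddChar.map_add_eq_mul, weylPhase, ← Finset.sum_neg_distrib, ← Finset.sum_add_distrib]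
      congr 1
      refine Finset.sum_congr rfl fun j _ => ?_
      simp only [Z, AddEquiv.apply_symm_apply]
      ring
    simp only [Matrix.smul_apply, Matrix.sum_apply, weylMatrix_apply, h1, smul_eq_mul, mul_ite, mul_zero, h2]
    by_cases hu : u = x
    · subst hu
      have h3 : (fun j => e.symm (e (u j) - (e (u j) - e (y j)))) = y := by
        funext j
        simp
      rw [h3]
      by_cases hv : v = y
      · subst hv
        simp
      · simp [hv, Ne.symm hv]
    · rw [single_apply_of_row_ne (Ne.symm hu)]
      have h4 : (fun j => e (u j) - e (x j)) ≠ 0 := fun h4 => hu (by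
        funext j
        exact e.injective (sub_eq_zero.1 (congrFun h4 j)))
      split_ifs
      · rw [sum_addChar_dotProduct_eq_zero hψ h4, mul_zero]
      · simp
  rw [key]
  exact Submodule.smul_mem _ _ (Submodule.sum_mem _ fun b _ =>
    Submodule.smul_mem _ _ (Submodule.subset_span ⟨Z b, rfl⟩))

/-- The tensor product of two Weyl systems. -/
noncomputable def WeylSystem.prod {Z Z' X X' : Type*} [AddCommGroup Z] [AddCommGroup Z']
    [Fintype X] [DecidableEq X] [Fintype X'] [DecidableEq X'] (W : WeylSystem Z X)
    (W' : WeylSystem Z' X') : WeylSystem (Z × Z') (X × X') where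
  op s := W.op s.1 ⊗ₖ W'.op s.2
  cocycle s t := W.cocycle s.1 t.1 * W'.cocycle s.2 t.2
  op_zero := by
    rw [Prod.fst_zero, Prod.snd_zero, W.op_zero, W'.op_zero, one_kronecker_one]
  op_mul s t := by
    rw [← mul_kronecker_mul, W.op_mul, W'.op_mul, smul_kronecker, kronecker_smul, smul_smul]
    rfl
  op_unitary s := by
    rw [conjTranspose_kronecker, ← mul_kronecker_mul, W.op_unitary, W'.op_unitary,
      one_kronecker_one]
  trace_op s hs := by
    rw [trace_kronecker]
    by_cases h : s.1 = 0
    · rw [W'.trace_op s.2 fun h' => hs (Prod.ext h h'), mul_zero]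
    · rw [W.trace_op s.1 h, zero_mul]

end WeylOperators

/-! ### Errors supported on a set of positions -/

section LocalErrors

variable {K F : Type*} [AddCommGroup K] [Field F] {q n : ℕ}

theorem weylMatrix_apply_of_forall_notMem (p : K ≃+ F × F) (ψ : AddChar F ℂ) (e : Fin q ≃ F)
    {T : Finset (Fin n)} {z : Fin n → K} (hz : ∀ i, i ∉ T → z i = 0) (x y : Qudits q n) :
    weylMatrix p ψ e z x y = if ∀ i, i ∉ T → x i = y i then
      weylMatrix p ψ e (fun i : T => z i) (fun i => x i) (fun i => y i) else 0 := by
  have hphase : weylPhase p e z x = weylPhase p e (fun i : T => z i) (fun i => x i) := by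
    rw [weylPhase, weylPhase, Finset.sum_coe_sort T fun i => (p (z i)).2 * e (x i)]
    refine (Finset.sum_subset (Finset.subset_univ T) fun i _ hi => ?_).symm
    rw [hz i hi, map_zero, Prod.snd_zero, zero_mul]
  have hshift : ∀ i, i ∉ T → weylShift p e z x i = x i := fun i hi => by
    simp [weylShift, hz i hi]
  rw [weylMatrix_apply, weylMatrix_apply, hphase, ← ite_and]
  refine if_congr ?_ rfl rfl
  constructor
  · rintro rfl
    exact ⟨fun i hi => (hshift i hi).symm, rfl⟩
  · rintro ⟨h, h'⟩
    funext i
    by_cases hi : i ∈ T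
    · exact congrFun h' ⟨i, hi⟩
    · rw [hshift i hi, h i hi]

theorem actsOn_weylMatrix (p : K ≃+ F × F) (ψ : AddChar F ℂ) (e : Fin q ≃ F)
    {T : Finset (Fin n)} {z : Fin n → K} (hz : ∀ i, i ∉ T → z i = 0) :
    ActsOn (weylMatrix p ψ e z) T := by
  refine ⟨weylMatrix p ψ e (fun i : T => z i), fun x y => ⟨fun h => ?_, fun h => ?_⟩⟩
  · rw [weylMatrix_apply_of_forall_notMem p ψ e hz, if_pos h]
  · rw [weylMatrix_apply_of_forall_notMem p ψ e hz, if_neg h]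

theorem ActsOn.mem_span_weylMatrix [Fintype F] (p : K ≃+ F × F) {ψ : AddChar F ℂ} (hψ : ψ ≠ 1)
    (e : Fin q ≃ F) {T : Finset (Fin n)} {E : Matrix (Qudits q n) (Qudits q n) ℂ}
    (hE : ActsOn E T) :
    E ∈ Submodule.span ℂ (weylMatrix p ψ e '' {z : Fin n → K | ∀ i, i ∉ T → z i = 0}) := by
  obtain ⟨M, hM⟩ := hE
  -- The linear map `N ↦ N ⊗ id`; it sends a Weyl operator on `T` to the one whose label is extended
  -- by zero.
  let ι : Matrix (T → Fin q) (T → Fin q) ℂ →ₗ[ℂ] Matrix (Qudits q n) (Qudits q n) ℂ :=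
    { toFun := fun N => Matrix.of fun x y =>
        if ∀ i, i ∉ T → x i = y i then N (fun i => x i) (fun i => y i) else 0
      map_add' := fun N N' => by
        ext x y
        simp only [Matrix.add_apply, of_apply]
        split_ifs <;> simp
      map_smul' := fun a N => by
        ext x y
        simp only [Matrix.smul_apply, of_apply]
        split_ifs <;> simp }
  have hEι : E = ι M := by
    ext x y
    change E x y = if ∀ i, i ∉ T → x i = y i then M (fun i => x i) (fun i => y i) else 0
    split_ifs with h
    · exact (hM x y).1 h
    · exact (hM x y).2 h
  have hMtop : M ∈ Submodule.span ℂ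
      (Set.range (weylMatrix p ψ e : (T → K) → Matrix (T → Fin q) (T → Fin q) ℂ)) := by
    rw [span_range_weylMatrix p hψ e]
    exact Submodule.mem_top
  rw [hEι]
  have h := Submodule.mem_map_of_mem (f := ι) hMtop
  rw [Submodule.map_span] at h
  refine Submodule.span_mono ?_ h
  rintro _ ⟨_, ⟨w, rfl⟩, rfl⟩
  have hz : ∀ i, i ∉ T → (fun i => if h : i ∈ T then w ⟨i, h⟩ else 0 : Fin n → K) i = 0 :=
    fun i hi => dif_neg hi
  refine ⟨_, hz, ?_⟩
  ext x y
  rw [weylMatrix_apply_of_forall_notMem p ψ e hz]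
  simp only [Finset.coe_mem, dif_pos, Subtype.coe_eta]
  rfl

theorem applyError_eq_mulVec {c : ℕ} (E : Matrix (Qudits q n) (Qudits q n) ℂ)
    (φ : Qudits q n × Qudits q c → ℂ) :
    applyError E φ = (E ⊗ₖ (1 : Matrix (Qudits q c) (Qudits q c) ℂ)) *ᵥ φ := by
  funext r
  simp [applyError, mulVec, dotProduct, Fintype.sum_prod_type, kroneckerMap_apply, one_apply]

end LocalErrors

open Matrix Kronecker

/-! ### Encoders from maximally mixed receiver states -/

section Encoder

theorem exists_orthonormal_spanning {X I : Type*} [Fintype X] [Fintype I] [DecidableEq I]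
    (Q : Submodule ℂ (X → ℂ)) (h : Module.finrank ℂ Q = Fintype.card I) :
    ∃ φ : I → X → ℂ, (∀ i, φ i ∈ Q) ∧
      (∀ i j, star (φ i) ⬝ᵥ φ j = if i = j then 1 else 0) ∧
      Submodule.span ℂ (Set.range φ) = Q := by
  -- Passing to Euclidean space makes orthonormal bases available.
  let ε := WithLp.linearEquiv 2 ℂ (X → ℂ)
  let Q' : Submodule ℂ (EuclideanSpace ℂ X) := Q.map (ε.symm : (X → ℂ) →ₗ[ℂ] EuclideanSpace ℂ X)
  have hQ' : Module.finrank ℂ Q' = Fintype.card I := by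
    rw [← h]
    exact LinearEquiv.finrank_map_eq ε.symm Q
  let b := (stdOrthonormalBasis ℂ Q').reindex (Fintype.equivOfCardEq (by simp [hQ']) :
    Fin (Module.finrank ℂ Q') ≃ I)
  have hQε : Q = Q'.map (ε : EuclideanSpace ℂ X →ₗ[ℂ] (X → ℂ)) := by
    ext x
    simp [Q']
  have hb : Submodule.span ℂ (Set.range fun i => (b i : EuclideanSpace ℂ X)) = Q' := by
    have h1 : Submodule.span ℂ (Set.range b) = ⊤ := by
      rw [← b.coe_toBasis]
      exact b.toBasis.span_eq
    have h2 := congrArg (Submodule.map Q'.subtype) h1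
    rw [Submodule.map_span, Submodule.map_top, Submodule.range_subtype, ← Set.range_comp] at h2
    exact h2
  refine ⟨fun i => ε (b i : EuclideanSpace ℂ X), fun i => ?_, fun i j => ?_, ?_⟩
  · rw [hQε]
    exact Submodule.mem_map_of_mem (f := (ε : EuclideanSpace ℂ X →ₗ[ℂ] (X → ℂ))) (b i).2
  · have h1 := orthonormal_iff_ite.1 b.orthonormal i j
    rw [Submodule.coe_inner, EuclideanSpace.inner_eq_star_dotProduct, dotProduct_comm] at h1
    exact h1
  · rw [hQε]
    refine Eq.trans ?_ (congrArg (Submodule.map (ε : EuclideanSpace ℂ X →ₗ[ℂ] (X → ℂ))) hb)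
    rw [Submodule.map_span, ← Set.range_comp]
    rfl

/-- A subspace of dimension `q ^ κ` in which the receiver's qudits are maximally mixed is the range
of an entanglement-assisted encoder. -/
theorem exists_eaEncode_range {q n κ c : ℕ} (hq : 0 < q)
    (Q : Submodule ℂ (Qudits q n × Qudits q c → ℂ)) (hrank : Module.finrank ℂ Q = q ^ κ)
    (hmixed : ∀ φ ∈ Q, ∀ χ ∈ Q, ∀ M : Matrix (Qudits q c) (Qudits q c) ℂ,
      star φ ⬝ᵥ (((1 : Matrix (Qudits q n) (Qudits q n) ℂ) ⊗ₖ M) *ᵥ χ) =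
        M.trace / (q : ℂ) ^ c * (star φ ⬝ᵥ χ)) :
    ∃ V : Matrix (Qudits q n) (Qudits q κ × Qudits q c) ℂ,
      V.conjTranspose * V = 1 ∧ Q = LinearMap.range (eaEncode V) := by
  obtain ⟨φ, hφQ, hφ, hspan⟩ := exists_orthonormal_spanning (I := Qudits q κ) Q (by simp [hrank])
  have hqc : (0 : ℝ) < (q : ℝ) ^ c := pow_pos (Nat.cast_pos.2 hq) c
  have hr0 : (Real.sqrt ((q : ℝ) ^ c) : ℂ) ≠ 0 :=
    Complex.ofReal_ne_zero.2 (Real.sqrt_pos.2 hqc).ne'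
  have hrr : (Real.sqrt ((q : ℝ) ^ c) : ℂ) * (Real.sqrt ((q : ℝ) ^ c) : ℂ) = (q : ℂ) ^ c := by
    rw [← Complex.ofReal_mul, Real.mul_self_sqrt hqc.le]
    push_cast
    rfl
  set r : ℂ := (Real.sqrt ((q : ℝ) ^ c) : ℂ) with hr
  have hstar : star r = r := Complex.conj_ofReal _
  -- The factor `r` cancels the amplitude `q^{-c/2}` of the entangled state.
  let V : Matrix (Qudits q n) (Qudits q κ × Qudits q c) ℂ := fun a sb => r * φ sb.1 (a, sb.2)
  refine ⟨V, ?_, ?_⟩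
  · ext ⟨s, b⟩ ⟨s', b'⟩
    -- Testing mixedness on matrix units gives all inner products of the columns of `V`.
    have h1 := hmixed (φ s) (hφQ s) (φ s') (hφQ s') (single b b' 1)
    have h2 : star (φ s) ⬝ᵥ (((1 : Matrix (Qudits q n) (Qudits q n) ℂ) ⊗ₖ single b b' 1) *ᵥ φ s') =
        ∑ a, star (φ s (a, b)) * φ s' (a, b') := by
      simp [dotProduct, mulVec, Fintype.sum_prod_type, kroneckerMap_apply, one_apply,
        single_apply, ite_and]
    have h3 : (Vᴴ * V) (s, b) (s', b') = (q : ℂ) ^ c * ∑ a, star (φ s (a, b)) * φ s' (a, b') := by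
      rw [mul_apply, Finset.mul_sum]
      refine Finset.sum_congr rfl fun a _ => ?_
      rw [conjTranspose_apply]
      change star (r * φ s (a, b)) * (r * φ s' (a, b')) = _
      rw [star_mul', hstar, ← hrr]
      ring
    have hqc' : (q : ℂ) ^ c ≠ 0 := pow_ne_zero _ (Nat.cast_ne_zero.2 hq.ne')
    rw [h3, ← h2, h1, hφ, one_apply]
    by_cases hb : b = b'
    · subst hb
      by_cases hs : s = s'
      · subst hs
        simp [hqc']
      · simp [hs]
    · simp [hb, trace_single_eq_of_ne]
  · have henc : ∀ ψ : Qudits q κ → ℂ, eaEncode V ψ = ∑ s, ψ s • φ s := by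
      intro ψ
      funext p
      obtain ⟨a, b'⟩ := p
      change ∑ s, ∑ b, V a (s, b) * (ψ s * maxEntangled q c (b, b')) = _
      rw [Finset.sum_apply]
      refine Finset.sum_congr rfl fun s _ => ?_
      rw [Finset.sum_eq_single b']
      · simp only [maxEntangled, if_true, V, Pi.smul_apply, smul_eq_mul, Complex.ofReal_inv]
        rw [← hr]
        field_simp
      · intro b _ hb
        simp [maxEntangled, hb]
      · simp
    rw [← hspan, ← Fintype.range_linearCombination ℂ φ]
    ext χ
    simp only [LinearMap.mem_range, henc, Fintype.linearCombination_apply]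

end Encoder

/-! ### The quantum code of the Hermitian construction -/

section HermitianStabilizer

variable {K : Type*} [Field K] {q n c : ℕ}

theorem finrank_eq_of_mul_eq {q m k κ N : ℕ} (hq : 0 < q) (h : m * (q ^ 2) ^ k = q ^ N)
    (hκ : κ + 2 * k = N) : m = q ^ κ := by
  rw [← hκ, pow_add, pow_mul] at h
  exact Nat.eq_of_mul_eq_mul_right (pow_pos (pow_pos hq 2) k) h

/-- The second coordinate of the Hermitian form is the symplectic form that governs commutation. -/
theorem weylSystem_cocycle_comm {F L : Type*} [Field F] [Fintype F] [Fintype L] [DecidableEq L]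
    (p : K ≃+ F × F)
    (hp : ∀ x y : K, (p (x * y ^ q)).2 = (p x).2 * (p y).1 - (p x).1 * (p y).2)
    {ψ : AddChar F ℂ} (hψ : ψ ≠ 1) (e : L ≃ F) (z w : Fin n → K) :
    (weylSystem (Fin n) p hψ e).cocycle z w =
      ψ (p (hermForm q z w)).2 * (weylSystem (Fin n) p hψ e).cocycle w z := by
  change ψ _ = ψ _ * ψ _
  rw [← AddChar.map_add_eq_mul]
  congr 1
  rw [hermForm, map_sum, Prod.snd_sum]
  simp only [hp, ← Finset.sum_neg_distrib, ← Finset.sum_add_distrib]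
  exact Finset.sum_congr rfl fun j _ => by ring

theorem commute_prod_weylSystem_iff {F L : Type*} [Field F] [Fintype F] [Fintype L] [DecidableEq L]
    [Nonempty L] (p : K ≃+ F × F)
    (hp : ∀ x y : K, (p (x * y ^ q)).2 = (p x).2 * (p y).1 - (p x).1 * (p y).2)
    {ψ : AddChar F ℂ} (hψ : ψ ≠ 1) (e : L ≃ F) (s t : (Fin n → K) × (Fin c → K)) :
    Commute (((weylSystem (Fin n) p hψ e).prod (weylSystem (Fin c) p hψ e)).op s)
      (((weylSystem (Fin n) p hψ e).prod (weylSystem (Fin c) p hψ e)).op t) ↔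
      ψ (p (hermForm q s.1 t.1 + hermForm q s.2 t.2)).2 = 1 := by
  rw [WeylSystem.commute_op_iff]
  change (weylSystem (Fin n) p hψ e).cocycle s.1 t.1 * (weylSystem (Fin c) p hψ e).cocycle s.2 t.2 =
    (weylSystem (Fin n) p hψ e).cocycle t.1 s.1 * (weylSystem (Fin c) p hψ e).cocycle t.2 s.2 ↔ _
  rw [weylSystem_cocycle_comm p hp hψ e s.1, weylSystem_cocycle_comm p hp hψ e s.2, map_add,
    Prod.snd_add, AddChar.map_add_eq_mul, mul_mul_mul_comm]
  exact mul_eq_right₀ (mul_ne_zero (WeylSystem.cocycle_ne_zero _ _ _)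
    (WeylSystem.cocycle_ne_zero _ _ _))

/-- The stabilizer code on `n + c` qudits defined by `C` and an anti-isometry `C → K ^ c`. -/
theorem exists_stabilizerCode (hq : IsPrimePow q) (hK : Nat.card K = q ^ 2) {κ : ℕ}
    (C : Submodule K (Fin n → K))
    (hc : c + Module.finrank K (hermHull q C) = Module.finrank K C)
    (hκ : κ + 2 * Module.finrank K C = n + c) :
    ∃ (F : Type) (_ : Field F) (_ : Fintype F) (p : K ≃+ F × F) (ψ : AddChar F ℂ) (hψ : ψ ≠ 1)
      (e : Fin q ≃ F) (Q : Submodule ℂ (Qudits q n × Qudits q c → ℂ)),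
      Module.finrank ℂ Q = q ^ κ ∧
      (∀ φ ∈ Q, ∀ χ ∈ Q, ∀ M : Matrix (Qudits q c) (Qudits q c) ℂ,
        star φ ⬝ᵥ (((1 : Matrix (Qudits q n) (Qudits q n) ℂ) ⊗ₖ M) *ᵥ χ) =
          M.trace / (q : ℂ) ^ c * (star φ ⬝ᵥ χ)) ∧
      (∀ x, x ∉ hermDual q C → DetectsWith Q ((weylSystem (Fin n) p hψ e).op x) 0) ∧
      (∀ x ∈ hermHull q C, ∃ a ≠ 0, DetectsWith Q ((weylSystem (Fin n) p hψ e).op x) a) ∧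
      (∀ x ∈ hermDual q C, x ∉ hermHull q C → ∀ a,
        ¬ DetectsWith Q ((weylSystem (Fin n) p hψ e).op x) a) := by
  have hfin := finite_of_card_eq_sq hq hK
  obtain ⟨F, _, _, p, hF, hp⟩ := exists_symplectic_coordinates hq hK
  obtain ⟨ψ, hψ⟩ : ∃ ψ : AddChar F ℂ, ψ ≠ 1 := by
    obtain ⟨ψ, h⟩ := AddChar.exists_apply_ne_zero.2 (one_ne_zero (α := F))
    exact ⟨ψ, AddChar.ne_one_iff.2 ⟨1, h⟩⟩
  let e : Fin q ≃ F := Fintype.equivOfCardEq (by rw [Fintype.card_fin, hF])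
  have hne : Nonempty (Fin q) := ⟨⟨0, hq.pos⟩⟩
  obtain ⟨u, hu, hus⟩ := exists_anti_isometry hq hK c C hc
  let W₁ := weylSystem (Fin n) p hψ e
  let W₂ := weylSystem (Fin c) p hψ e
  let W := W₁.prod W₂
  -- The stabilizer is the graph of `u`, on which the two Hermitian forms cancel.
  let f : C →+ (Fin n → K) × (Fin c → K) :=
    { toFun := fun y => (y, u y)
      map_zero' := by simp
      map_add' := fun y y' => by simp }
  have hf : Function.Injective f := fun y y' h => Subtype.ext (Prod.ext_iff.1 h).1
  let S := f.range
  have hS : ∀ s ∈ S, ∀ t ∈ S, Commute (W.op s) (W.op t) := by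
    rintro _ ⟨y, rfl⟩ _ ⟨y', rfl⟩
    refine (commute_prod_weylSystem_iff p hp hψ e _ _).2 ?_
    change ψ (p (hermForm q (y : Fin n → K) y' + hermForm q (u y) (u y'))).2 = 1
    rw [hu y y.2 y' y'.2, add_neg_cancel, map_zero, Prod.snd_zero, AddChar.map_zero_eq_one]
  have hcomm : ∀ t, (∀ s ∈ S, Commute (W.op s) (W.op t)) ↔
      ∀ y ∈ C, hermForm q y t.1 + hermForm q (u y) t.2 = 0 := by
    intro t
    constructor
    · intro h y hy
      by_contra hne
      obtain ⟨g, hg⟩ := AddChar.ne_one_iff.1 hψ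
      set τ := hermForm q y t.1 + hermForm q (u y) t.2 with hτ
      -- Commutation controls only `ψ` of one coordinate of `τ`. As the graph is `K`-linear, `y` can
      -- be rescaled until that coordinate is `g`, where `ψ g ≠ 1`.
      have h1 := (commute_prod_weylSystem_iff p hp hψ e _ _).1
        (h (f ((p.symm (0, g) / τ) • ⟨y, hy⟩)) ⟨_, rfl⟩)
      apply hg
      change ψ (p (hermForm q ((p.symm (0, g) / τ) • y) t.1 +
        hermForm q (u ((p.symm (0, g) / τ) • y)) t.2)).2 = 1 at h1
      rwa [map_smul, hermForm_smul_left, hermForm_smul_left, ← mul_add, ← hτ,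
        div_mul_cancel₀ _ hne, AddEquiv.apply_symm_apply] at h1
    · rintro h _ ⟨y, rfl⟩
      refine (commute_prod_weylSystem_iff p hp hψ e _ _).2 ?_
      change ψ (p (hermForm q (y : Fin n → K) t.1 + hermForm q (u y) t.2)).2 = 1
      rw [h y y.2, map_zero, Prod.snd_zero, AddChar.map_zero_eq_one]
  have hform0 : ∀ {m : ℕ} (y : Fin m → K), hermForm q y 0 = 0 := fun y => by
    simp [hermForm, zero_pow hq.pos.ne']
  have hdual : ∀ x, (∀ s ∈ S, Commute (W.op s) (W.op (x, 0))) ↔ x ∈ hermDual q C := by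
    intro x
    rw [hcomm]
    simp only [hform0, add_zero]
    exact ⟨fun h y hy => hermForm_eq_zero_symm hq hK (h y hy),
      fun h y hy => hermForm_eq_zero_symm hq hK (h y hy)⟩
  have hhull : ∀ x, (x, 0) ∈ S ↔ x ∈ hermHull q C := by
    intro x
    constructor
    · rintro ⟨y, hy⟩
      obtain ⟨rfl, h0⟩ := Prod.ext_iff.1 hy
      refine ⟨y.2, fun y' hy' => ?_⟩
      have h1 := hu y y.2 y' hy'
      have h2 : u y = 0 := h0
      have h3 : hermForm q (0 : Fin c → K) (u y') = 0 := by simp [hermForm]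
      rw [h2, h3] at h1
      exact neg_eq_zero.1 h1.symm
    · rintro ⟨hx, hx'⟩
      refine ⟨⟨x, hx⟩, Prod.ext rfl ?_⟩
      funext i
      -- Surjectivity of `u` lets each coordinate of `u x` be tested by a vector of `C`.
      obtain ⟨y, hy, hyu⟩ := hus (Pi.single i 1)
      have h1 := hu x hx y hy
      rw [hx' y hy, hyu, neg_zero] at h1
      have h2 : u x i = 0 := by
        simpa [hermForm, Pi.single_apply, ite_pow, zero_pow hq.pos.ne'] using h1
      exact h2
  have hreceiver : ∀ w : Fin c → K, w ≠ 0 → ∃ s : S, ¬ Commute (W.op s) (W.op (0, w)) := by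
    intro w hw
    by_contra! h
    have h1 := (hcomm (0, w)).1 fun s hs => h ⟨s, hs⟩
    apply hw
    funext i
    obtain ⟨y, hy, hyu⟩ := hus (Pi.single i 1)
    have h2 := h1 y hy
    rw [hform0, zero_add, hyu] at h2
    simpa [hermForm, Pi.single_apply, hq.pos.ne'] using h2
  obtain ⟨lam, hlam⟩ := W.exists_isWeight S hS
  have hop : ∀ x (φ : Qudits q n × Qudits q c → ℂ),
      applyError (W₁.op x) φ = W.op (x, 0) *ᵥ φ := by
    intro x φ
    rw [applyError_eq_mulVec]
    change _ = (W₁.op x ⊗ₖ W₂.op 0) *ᵥ φ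
    rw [W₂.op_zero]
  refine ⟨F, inferInstance, inferInstance, p, ψ, hψ, e, W.stabilizerCode S lam, ?_, ?_, ?_, ?_, ?_⟩
  · refine finrank_eq_of_mul_eq (k := Module.finrank K C) (N := n + c) hq.pos ?_ hκ
    have h1 := W.finrank_stabilizerCode hlam
    have h2 : Nat.card S = (q ^ 2) ^ Module.finrank K C := by
      rw [← Nat.card_congr (AddMonoidHom.ofInjective hf).toEquiv,
        Module.natCard_eq_pow_finrank (K := K), hK]
    rw [← h2, h1]
    simp [pow_add]
  · intro φ hφ χ hχ M
    have hM : M ∈ Submodule.span ℂ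
        (Set.range (weylMatrix p ψ e : (Fin c → K) → Matrix (Qudits q c) (Qudits q c) ℂ)) := by
      rw [span_range_weylMatrix p hψ e]
      exact Submodule.mem_top
    induction hM using Submodule.span_induction with
    | mem M hM =>
      obtain ⟨w, rfl⟩ := hM
      by_cases hw : w = 0
      · subst hw
        change star φ ⬝ᵥ ((1 ⊗ₖ W₂.op 0) *ᵥ χ) = (W₂.op 0).trace / _ * _
        have hqc : (q : ℂ) ^ c ≠ 0 := pow_ne_zero _ (Nat.cast_ne_zero.2 hq.pos.ne')
        rw [W₂.op_zero, one_kronecker_one, one_mulVec, trace_one]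
        simp [hqc]
      · obtain ⟨s, hs⟩ := hreceiver w hw
        have h1 := W.dotProduct_op_eq_zero hlam hs hφ hχ
        change star φ ⬝ᵥ ((W₁.op 0 ⊗ₖ W₂.op w) *ᵥ χ) = 0 at h1
        rw [W₁.op_zero] at h1
        rw [trace_weylMatrix p hψ e hw, zero_div, zero_mul]
        exact h1
    | zero => simp
    | add M N _ _ hM hN =>
      rw [kronecker_add, add_mulVec, dotProduct_add, hM, hN, trace_add]
      ring
    | smul a M _ hM =>
      rw [kronecker_smul, smul_mulVec, dotProduct_smul, hM, trace_smul, smul_eq_mul, smul_eq_mul]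
      ring
  · intro x hx φ hφ χ hχ
    rw [← hdual] at hx
    push Not at hx
    obtain ⟨s, hs, hsx⟩ := hx
    rw [zero_mul, hop]
    exact W.dotProduct_op_eq_zero hlam (s := ⟨s, hs⟩) hsx hφ hχ
  · intro x hx
    rw [← hhull] at hx
    refine ⟨lam ⟨_, hx⟩, fun h0 => ?_, fun φ _ χ hχ => ?_⟩
    · have := hlam.star_mul_self ⟨_, hx⟩
      rw [h0, mul_zero] at this
      exact zero_ne_one this
    · rw [hop, W.mem_stabilizerCode.1 hχ ⟨_, hx⟩, dotProduct_smul, smul_eq_mul]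
  · intro x hx hx' a h
    rw [← hhull] at hx'
    refine W.not_exists_dotProduct_op_eq hlam hx' ((hdual x).2 hx) a fun φ hφ χ hχ => ?_
    rw [← hop]
    exact h φ hφ χ hχ

/-- Detection and the normalized trace are both linear in the error. -/
theorem DetectsErrorsOn.of_weyl {κ : ℕ} {F : Type*} [Field F] [Fintype F] {p : K ≃+ F × F}
    {ψ : AddChar F ℂ} (hψ : ψ ≠ 1) {e : Fin q ≃ F}
    {Q : Submodule ℂ (Qudits q n × Qudits q c → ℂ)} {T : Finset (Fin n)}
    (h : ∀ z : Fin n → K, (∀ i, i ∉ T → z i = 0) →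
      ∃ a : ℂ, DetectsWith Q ((weylSystem (Fin n) p hψ e).op z) a ∧
        (κ = 0 → a = ((weylSystem (Fin n) p hψ e).op z).trace / (q : ℂ) ^ n)) :
    DetectsErrorsOn κ Q T := by
  intro E hE
  have hspan := hE.mem_span_weylMatrix p hψ e
  clear hE
  induction hspan using Submodule.span_induction with
  | mem E hE =>
    obtain ⟨z, hz, rfl⟩ := hE
    exact h z hz
  | zero =>
    refine ⟨0, fun φ _ χ _ => ?_, fun _ => by simp⟩
    rw [applyError_eq_mulVec]
    simp
  | add E E' _ _ hE hE' =>
    obtain ⟨a, ha, ha0⟩ := hE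
    obtain ⟨b, hb, hb0⟩ := hE'
    refine ⟨a + b, fun φ hφ χ hχ => ?_, fun h0 => ?_⟩
    · have h1 := ha φ hφ χ hχ
      have h2 := hb φ hφ χ hχ
      rw [applyError_eq_mulVec] at h1 h2 ⊢
      rw [add_kronecker, add_mulVec, dotProduct_add, h1, h2, add_mul]
    · rw [ha0 h0, hb0 h0, trace_add, add_div]
  | smul r E _ hE =>
    obtain ⟨a, ha, ha0⟩ := hE
    refine ⟨r * a, fun φ hφ χ hχ => ?_, fun h0 => ?_⟩
    · have h1 := ha φ hφ χ hχ
      rw [applyError_eq_mulVec] at h1 ⊢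
      rw [smul_kronecker, smul_mulVec, dotProduct_smul, h1, smul_eq_mul, mul_assoc]
    · rw [ha0 h0, trace_smul, smul_eq_mul, mul_div_assoc]

/-- The dual has dimension `n - k = κ + (k - c)` and the hull `k - c`. This matches the two cases of
the classical distance with the purity clause for `κ = 0`. -/
theorem hermDual_le_iff_eq_zero (hq : IsPrimePow q) (hK : Nat.card K = q ^ 2) {κ δ : ℕ}
    {C : Submodule K (Fin n → K)} (hC : IsHermitianConstruction q C κ δ c) :
    hermDual q C ≤ C ↔ κ = 0 := by
  have h1 := finrank_add_finrank_hermDual hq hK C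
  have h2 := hC.ebits
  have h3 := hC.logical
  constructor
  · intro h
    have h4 : hermHull q C = hermDual q C := inf_eq_right.2 h
    rw [h4] at h2
    omega
  · rintro rfl
    have h4 : hermHull q C = hermDual q C :=
      Submodule.eq_of_le_of_finrank_eq inf_le_right (by omega)
    exact inf_eq_right.1 h4

/-- The entanglement-assisted code of the Hermitian construction. -/
theorem exists_isEAQECC (hq : IsPrimePow q) (hK : Nat.card K = q ^ 2) {κ δ : ℕ}
    {C : Submodule K (Fin n → K)} (hC : IsHermitianConstruction q C κ δ c) :
    ∃ Q : Submodule ℂ (Qudits q n × Qudits q c → ℂ), IsEAQECC q n κ δ c Q := by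
  classical
  obtain ⟨F, _, _, p, ψ, hψ, e, Q, hrank, hmixed, hdual, hhull, hnot⟩ :=
    exists_stabilizerCode hq hK C hC.ebits hC.logical
  have hκ := hermDual_le_iff_eq_zero hq hK hC
  -- The labels whose nonzero members are the Weyl errors violating the detection requirement.
  set D : Set (Fin n → K) := if hermDual q C ≤ C then (hermDual q C : Set (Fin n → K)) else
    (hermDual q C : Set (Fin n → K)) \ (hermHull q C : Set (Fin n → K)) with hD
  have hδ : δ = minWt D := by
    rw [hD]
    split_ifs with h
    · exact hC.dist_of_le h
    · exact hC.dist_of_not_le h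
  have hcard : ∀ (z : Fin n → K) (T : Finset (Fin n)), (∀ i, i ∉ T → z i = 0) →
      hammingNorm z ≤ T.card := fun z T hz => Finset.card_le_card fun i hi => by
    by_contra h
    exact (Finset.mem_filter.1 hi).2 (hz i h)
  have hQ : ∃ φ ∈ Q, star φ ⬝ᵥ φ ≠ 0 := by
    open scoped ComplexOrder in
    have hb : Q ≠ ⊥ := fun h => by
      rw [h, finrank_bot] at hrank
      exact (pow_pos hq.pos κ).ne hrank
    obtain ⟨φ, hφ, hφ0⟩ := Submodule.exists_mem_ne_zero_of_ne_bot hb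
    exact ⟨φ, hφ, dotProduct_star_self_eq_zero.not.2 hφ0⟩
  refine ⟨Q, exists_eaEncode_range hq.pos Q hrank hmixed, ⟨?_, ?_⟩, ?_⟩
  · rw [hδ]
    exact minWt_le_succ D
  · intro T hT
    refine DetectsErrorsOn.of_weyl hψ (p := p) (e := e) fun z hz => ?_
    have hqn : (q : ℂ) ^ n ≠ 0 := pow_ne_zero _ (Nat.cast_ne_zero.2 hq.pos.ne')
    by_cases hz0 : z = 0
    · subst hz0
      refine ⟨1, fun φ _ χ _ => ?_, fun _ => ?_⟩
      · rw [applyError_eq_mulVec, WeylSystem.op_zero, one_kronecker_one, one_mulVec, one_mul]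
      · rw [WeylSystem.op_zero, trace_one]
        simp [hqn]
    · have hzD : z ∉ D := fun h => by
        have := minWt_le h hz0
        have := hcard z T hz
        omega
      by_cases hzd : z ∈ hermDual q C
      · by_cases hle : hermDual q C ≤ C
        · rw [hD, if_pos hle] at hzD
          exact absurd hzd hzD
        · rw [hD, if_neg hle] at hzD
          have hzh : z ∈ hermHull q C := by
            by_contra h
            exact hzD ⟨hzd, h⟩
          obtain ⟨a, -, ha⟩ := hhull z hzh
          exact ⟨a, ha, fun h0 => absurd (hκ.2 h0) hle⟩
      · exact ⟨0, hdual z hzd, fun _ => by rw [WeylSystem.trace_op _ z hz0, zero_div]⟩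
  · rintro d ⟨hd, hdet⟩
    by_contra hlt
    obtain ⟨w, hw, hw0, hwt⟩ := exists_hammingNorm_eq_minWt_of_le (S := D) (by omega)
    obtain ⟨a, ha, ha0⟩ := hdet (Finset.univ.filter fun i => w i ≠ 0)
      (by change hammingNorm w < d; omega) ((weylSystem (Fin n) p hψ e).op w)
      (actsOn_weylMatrix p ψ e fun i hi => by simpa using hi)
    by_cases hle : hermDual q C ≤ C
    · rw [hD, if_pos hle] at hw
      -- For `κ = 0` the traceless error `w` stabilizes `Q` up to the nonzero scalar `b`, against
      -- purity.
      obtain ⟨b, hb0, hb⟩ := hhull w ⟨hle hw, hw⟩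
      have ha1 := ha0 (hκ.1 hle)
      rw [WeylSystem.trace_op _ w hw0, zero_div] at ha1
      obtain ⟨φ, hφ, hφ0⟩ := hQ
      have h1 := (hb φ hφ φ hφ).symm.trans (ha φ hφ φ hφ)
      rw [ha1] at h1
      exact hb0 (mul_right_cancel₀ hφ0 h1)
    · rw [hD, if_neg hle] at hw
      exact hnot w hw.1 hw.2 a ha

end HermitianStabilizer

/-! ### Less entanglement from one more qudit -/

theorem mainTheorem3 {K : Type*} [Field K] (q : ℕ) (hq : IsPrimePow q) (hK : Nat.card K = q ^ 2)
    (n κ δ c : ℕ) (C : Submodule K (Fin n → K))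
    (hQ : IsHermitianConstruction q C κ δ c)
    (hpure : δ = minWt (hermDual q C : Set (Fin n → K)))
    (hc : 1 ≤ c) :
    (∃ v ∈ C, hermForm q v v ≠ 0) ∧
    ∀ v ∈ C, hermForm q v v ≠ 0 →
      ∃ β : K, β ≠ 0 ∧ hermForm q v v + β ^ (q + 1) = 0 ∧
      ∃ C' : Submodule K (Fin (n + 1) → K),
        hermDual q C' = extendCode (hermDual q C) v β ∧
        minWt (hermDual q C' : Set (Fin (n + 1) → K)) =
          min δ (minWt ((hermDual q C ⊔ Submodule.span K {v} : Submodule K (Fin n → K)) :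
            Set (Fin n → K)) + 1) ∧
        ∃ δ' : ℕ, δ' ≤ δ ∧ IsHermitianConstruction q C' κ δ' (c - 1) ∧
          ∃ Q' : Submodule ℂ (Qudits q (n + 1) × Qudits q (c - 1) → ℂ),
            IsEAQECC q (n + 1) κ δ' (c - 1) Q' := by
  refine ⟨?_, fun v hv hvv => ?_⟩
  · have := hQ.ebits
    exact exists_hermForm_self_ne_zero_of_finrank_lt hq hK (by omega)
  · obtain ⟨β, hβ⟩ := exists_pow_succ_eq_neg hq hK v
    have hβ0 : β ≠ 0 := by
      rintro rfl
      rw [zero_pow q.succ_ne_zero, add_zero] at hβ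
      exact hvv hβ
    have hdd := hermDual_hermDual hq hK (extendCode (hermDual q C) v β)
    obtain ⟨δ', hδ', hC'⟩ :=
      exists_isHermitianConstruction_extendCode hq hK hQ hpure hc hv hvv hβ0 hβ
    refine ⟨β, hβ0, hβ, _, hdd, ?_, δ', hδ', hC', exists_isEAQECC hq hK hC'⟩
    rw [hdd, minWt_extendCode hv hvv hβ0, hpure]
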